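/- Let $F$ be a field of any characteristic, let $G$ be a finite group, and let $A=\bigoplus_{g\in G}A_g$ be an infinite, associative, not necessarily unital, $G$-graded $F$-algebra that is $G$-simple (that is, $A^2\neq 0$ and the only $G$-graded two-sided ideals of $A$ are $0$ and $A$) and PI (that is, $A$ satisfies a non-zero ordinary polynomial identity with coefficients in $F$). (The algebra $A$ is automatically infinite when $F$ is infinite.) Then there are an algebraically closed extension field $K$ of $F$, a subgroup $H\le G$, a $2$-cocycle $\alpha\in Z^2(H,K^\times)$ for the trivial action of $H$ on $K^\times$, an integer $n\geq 1$ and $\mathfrak g=(g_1,\dots,g_n)\in G^n$ such that, for the $G$-graded $K$-algebra $$B=K^{\alpha}H\otimes_K M_{\mathfrak g}(K),$$ one has $$\mathrm{id}_{G,F}(A)=\mathrm{id}_{G,F}(B).$$ Here $K^\alpha H$ is the twisted group algebra, with $K$-basis $(u_h)_{h\in H}$ and multiplication $u_hu_{h'}=\alpha(h,h')u_{hh'}$; as an algebra $B=K^\alpha H\otimes_K M_n(K)$, and its component of degree $g\in G$ is $B_g=\mathrm{span}_K\{u_h\otimes e_{ij} : h\in H,\ g=g_i^{-1}hg_j\}$.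 For a $G$-graded $F$-algebra $C$, $\mathrm{id}_{G,F}(C)$ is the set of $G$-graded identities of $C$ with coefficients in $F$: the polynomials $f$ in the free associative algebra $F\langle x_{i,g} : i\in\mathbb N,\ g\in G\rangle$ that vanish under all substitutions $x_{i,g}\mapsto c_{i,g}$ with $c_{i,g}\in C_g$. -/

import Mathlib

open scoped TensorProduct

universe u v w

noncomputable section

namespace GradedPI

/-! ### Graded algebras, graded ideals, graded simplicity

Algebras are associative, and not assumed to be unital. -/

section Graded

variable {F : Type*} {G : Type*} {A : Type*} [Field F] [Group G] [NonUnitalRing A] [Module F A]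

/-- The subspaces `𝒜 g` form a `G`-grading of the `F`-algebra `A`: `A = ⨁ g, 𝒜 g` and
`𝒜 g * 𝒜 h ⊆ 𝒜 (g * h)`. -/
structure IsGrading (𝒜 : G → Submodule F A) : Prop where
  indep : iSupIndep 𝒜
  iSup_eq_top : ⨆ g, 𝒜 g = ⊤
  mul_mem : ∀ {g h : G} {a b : A}, a ∈ 𝒜 g → b ∈ 𝒜 h → a * b ∈ 𝒜 (g * h)

/-- `I` is a `G`-graded two-sided ideal: a two-sided ideal with `I = ∑ g, I ∩ 𝒜 g`. -/
structure IsGradedIdeal (𝒜 : G → Submodule F A) (I : Submodule F A) : Prop where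
  mul_mem_left : ∀ (a : A) {x : A}, x ∈ I → a * x ∈ I
  mul_mem_right : ∀ (a : A) {x : A}, x ∈ I → x * a ∈ I
  graded : I = ⨆ g, I ⊓ 𝒜 g

/-- `A` is `G`-simple: `A² ≠ 0` and the only graded two-sided ideals are `0` and `A`. -/
structure IsGradedSimple (𝒜 : G → Submodule F A) : Prop where
  sq_ne_zero : ∃ a b : A, a * b ≠ 0
  eq_bot_or_eq_top : ∀ I : Submodule F A, IsGradedIdeal 𝒜 I → I = ⊥ ∨ I = ⊤

end Graded

/-! ### Polynomial identities

A non-commutative polynomial is evaluated in the unitization `F ⊕ A` of `A`, so that polynomials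
with a constant term make sense for a non-unital `A`. A polynomial that vanishes on `A` in this
sense has zero constant term; when `A` is unital and non-zero, the polynomials vanishing in this
sense are exactly those that vanish when evaluated in `A` itself. -/

section Identities

variable (F : Type*) {G : Type*} {A : Type*} [Field F] [NonUnitalRing A]
  [Module F A] [IsScalarTower F A A] [SMulCommClass F A A]

/-- The value of the polynomial `f` in non-commuting variables indexed by `X` at `a : X → A`. -/
def evalPoly {X : Type*} (a : X → A) (f : FreeAlgebra F X) : Unitization F A :=
  FreeAlgebra.lift F (fun i => (Unitization.inr (a i) : Unitization F A)) f

variable (A) in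
/-- `A` is a PI algebra over `F`: it satisfies a non-zero ordinary polynomial identity. -/
def IsPI : Prop :=
  ∃ f : FreeAlgebra F ℕ, f ≠ 0 ∧ ∀ a : ℕ → A, evalPoly F a f = 0

/-- The set `id_{G,F}(A) ⊆ F⟨X_G⟩` of `G`-graded identities of `A` with coefficients in `F`;
the variable `x_{i,g}` is the generator `(i, g)`, and takes values in `𝒜 g`. -/
def gradedIdentities (𝒜 : G → Submodule F A) : Set (FreeAlgebra F (ℕ × G)) :=
  {f | ∀ a : ℕ × G → A, (∀ i g, a (i, g) ∈ 𝒜 g) → evalPoly F a f = 0}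

end Identities

/-! ### Twisted group algebras -/

/-- A 2-cocycle `α ∈ Z²(H, Kˣ)`, for the trivial action of `H` on `Kˣ`. -/
structure TwoCocycle (H : Type*) (K : Type*) [Group H] [Field K] where
  toFun : H → H → Kˣ
  cocycle : ∀ a b c : H, toFun a b * toFun (a * b) c = toFun b c * toFun a (b * c)

/-- The twisted group algebra `K^α H`: the `K`-vector space with basis `u_h` (`h ∈ H`) and
multiplication `u_a * u_b = α(a, b) u_{ab}`. -/
def TwistedGroupAlgebra {H : Type*} {K : Type*} [Group H] [Field K]
    (_α : TwoCocycle H K) : Type _ := H →₀ K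

namespace TwistedGroupAlgebra

variable {H : Type*} {K : Type*} [Group H] [Field K] (α : TwoCocycle H K)

instance : AddCommGroup (TwistedGroupAlgebra α) :=
  inferInstanceAs (AddCommGroup (H →₀ K))

instance {R : Type*} [CommSemiring R] [Algebra R K] : Module R (TwistedGroupAlgebra α) :=
  inferInstanceAs (Module R (H →₀ K))

instance {R : Type*} [CommSemiring R] [Algebra R K] :
    IsScalarTower R K (TwistedGroupAlgebra α) :=
  inferInstanceAs (IsScalarTower R K (H →₀ K))

/-- The element `x u_h`. -/
def single (h : H) (x : K) : TwistedGroupAlgebra α := Finsupp.single h x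

/-- The bilinear multiplication with `(x u_a) * (y u_b) = x y α(a, b) u_{ab}`. -/
def mulHom : (H →₀ K) →+ (H →₀ K) →+ (H →₀ K) :=
  Finsupp.liftAddHom fun a => AddMonoidHom.flip <| Finsupp.liftAddHom fun b =>
    AddMonoidHom.flip <|
    { toFun := fun x =>
        { toFun := fun y => Finsupp.single (a * b) (x * y * (α.toFun a b : K))
          map_zero' := by simp
          map_add' := fun y z => by rw [mul_add, add_mul, Finsupp.single_add] }
      map_zero' := by ext; simp
      map_add' := fun y z => by
        refine AddMonoidHom.ext fun t => ?_
        change (Finsupp.single _ _ : H →₀ K) = Finsupp.single _ _ + Finsupp.single _ _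
        rw [add_mul, add_mul, Finsupp.single_add] }

theorem mulHom_single (a b : H) (x y : K) :
    mulHom α (Finsupp.single a x) (Finsupp.single b y) =
      Finsupp.single (a * b) (x * y * (α.toFun a b : K)) := by
  simp only [mulHom, Finsupp.liftAddHom_apply_single, AddMonoidHom.flip_apply]
  rfl

instance : Mul (TwistedGroupAlgebra α) := ⟨fun f g => mulHom α f g⟩

instance : One (TwistedGroupAlgebra α) := ⟨single α 1 (((α.toFun 1 1)⁻¹ : Kˣ) : K)⟩

theorem one_def : (1 : TwistedGroupAlgebra α) = single α 1 (((α.toFun 1 1)⁻¹ : Kˣ) : K) := rfl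

theorem single_mul_single (a b : H) (x y : K) :
    single α a x * single α b y = single α (a * b) (x * y * (α.toFun a b : K)) :=
  mulHom_single α a b x y

theorem add_mul_aux (f g k : TwistedGroupAlgebra α) : (f + g) * k = f * k + g * k :=
  DFunLike.congr_fun (map_add (mulHom α) f g) k

theorem mul_add_aux (f g k : TwistedGroupAlgebra α) : f * (g + k) = f * g + f * k :=
  map_add (mulHom α f) g k

theorem zero_mul_aux (f : TwistedGroupAlgebra α) : 0 * f = 0 :=
  DFunLike.congr_fun (map_zero (mulHom α)) f

theorem mul_zero_aux (f : TwistedGroupAlgebra α) : f * 0 = 0 :=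
  map_zero (mulHom α f)

theorem induction {p : TwistedGroupAlgebra α → Prop} (f : TwistedGroupAlgebra α)
    (zero : p 0) (add : ∀ f g, p f → p g → p (f + g)) (sing : ∀ a x, p (single α a x)) : p f :=
  Finsupp.induction_linear f zero add sing

theorem smul_single {R : Type*} [CommSemiring R] [Algebra R K] (r : R) (a : H) (x : K) :
    r • single α a x = single α a (r • x) :=
  Finsupp.smul_single r a x

theorem cocycle_one_left (b : H) : α.toFun 1 b = α.toFun 1 1 := by
  have h := α.cocycle 1 1 b
  simp only [one_mul] at h
  exact (mul_right_cancel h).symm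

theorem cocycle_one_right (a : H) : α.toFun a 1 = α.toFun 1 1 := by
  have h := α.cocycle a 1 1
  simp only [mul_one] at h
  exact mul_right_cancel h

instance : Ring (TwistedGroupAlgebra α) :=
  { (inferInstance : AddCommGroup (TwistedGroupAlgebra α)) with
    mul := (· * ·)
    one := 1
    left_distrib := mul_add_aux α
    right_distrib := add_mul_aux α
    zero_mul := zero_mul_aux α
    mul_zero := mul_zero_aux α
    mul_assoc := fun f g k => by
      induction f using induction with
      | zero => simp only [zero_mul_aux]
      | add f₁ f₂ h₁ h₂ => simp only [add_mul_aux, h₁, h₂]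
      | sing a x =>
        induction g using induction with
        | zero => simp only [zero_mul_aux, mul_zero_aux]
        | add f₁ f₂ h₁ h₂ => simp only [add_mul_aux, mul_add_aux, h₁, h₂]
        | sing b y =>
          induction k using induction with
          | zero => simp only [mul_zero_aux]
          | add f₁ f₂ h₁ h₂ => simp only [mul_add_aux, h₁, h₂]
          | sing c z =>
            have h := congrArg (Units.val (α := K)) (α.cocycle a b c)
            simp only [Units.val_mul] at h
            simp only [single_mul_single, mul_assoc a b c]
            congr 1
            linear_combination (x * y * z) * h
    one_mul := fun f => by
      induction f using induction with
      | zero => simp only [mul_zero_aux]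
      | add f₁ f₂ h₁ h₂ => simp only [mul_add_aux, h₁, h₂]
      | sing a x =>
        rw [one_def, single_mul_single, one_mul, cocycle_one_left α a, mul_right_comm,
          Units.inv_mul, one_mul]
    mul_one := fun f => by
      induction f using induction with
      | zero => simp only [zero_mul_aux]
      | add f₁ f₂ h₁ h₂ => simp only [add_mul_aux, h₁, h₂]
      | sing a x =>
        rw [one_def, single_mul_single, mul_one, cocycle_one_right α a, mul_assoc,
          Units.inv_mul, mul_one] }

instance {R : Type*} [CommSemiring R] [Algebra R K] : Algebra R (TwistedGroupAlgebra α) :=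
  Algebra.ofModule
    (fun r f g => by
      induction f using induction with
      | zero => simp only [smul_zero, zero_mul]
      | add f₁ f₂ h₁ h₂ => simp only [smul_add, add_mul, h₁, h₂]
      | sing a x =>
        induction g using induction with
        | zero => simp only [smul_zero, mul_zero]
        | add f₁ f₂ h₁ h₂ => simp only [smul_add, mul_add, h₁, h₂]
        | sing b y => simp only [smul_single, single_mul_single, smul_mul_assoc])
    (fun r f g => by
      induction f using induction with
      | zero => simp only [smul_zero, zero_mul]
      | add f₁ f₂ h₁ h₂ => simp only [smul_add, add_mul, h₁, h₂]
      | sing a x =>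
        induction g using induction with
        | zero => simp only [smul_zero, mul_zero]
        | add f₁ f₂ h₁ h₂ => simp only [smul_add, mul_add, h₁, h₂]
        | sing b y =>
          simp only [smul_single, single_mul_single, smul_mul_assoc, mul_smul_comm])

end TwistedGroupAlgebra

/-- The natural `G`-grading of `K^α H` for a subgroup `H` of `G`: the component of degree `g` is
`K u_g` if `g ∈ H`, and `0` otherwise. -/
def twistedGrading {G : Type*} {K : Type*} [Group G] [Field K] {H : Subgroup G}
    (α : TwoCocycle H K) (g : G) : Submodule K (TwistedGroupAlgebra α) :=
  Submodule.span K {x | ∃ h : H, (h : G) = g ∧ x = TwistedGroupAlgebra.single α h 1}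

/-- The `G`-grading of `M_γ(B) = B ⊗ M_n(K)`, for a `G`-graded `K`-algebra `B` and `γ ∈ Gⁿ`: the
component of degree `g` is spanned by the `b ⊗ e_{ij}` with `b` homogeneous of degree `h` and
`g = γ_i⁻¹ h γ_j`. -/
def matrixGrading {G : Type*} {K : Type*} {B : Type*} [Group G] [Field K] [Ring B] [Algebra K B]
    (ℬ : G → Submodule K B) {n : ℕ} (γ : Fin n → G) (g : G) :
    Submodule K (B ⊗[K] Matrix (Fin n) (Fin n) K) :=
  Submodule.span K {x | ∃ (i j : Fin n) (h : G) (b : B),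
    b ∈ ℬ h ∧ g = (γ i)⁻¹ * h * γ j ∧ x = b ⊗ₜ[K] Matrix.single i j (1 : K)}

end GradedPI

end

open GradedPI

noncomputable section

namespace GradedPI

/-! ### Multilinear identities from arbitrary ones. -/

section Linearization

open Finset

/-! The plan is to find a field `C` over which `A` is finite-dimensional and central in the graded
sense, extend scalars to its algebraic closure, and classify the result.

Let `C` be the ring of endomorphisms of `A` commuting with all left and right multiplications and
with the projections onto the components. Graded simplicity says that `A` is a simple module over
the algebra generated by these operators, so `C` is a division ring by Schur. It is commutative
because its elements move across products. Jacobson density then approximates every `C`-linear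
operator (`IsGradedSimple.exists_denseCentroid`).

The polynomial identity forces `A` to have finite dimension over `C`. Regev's counting argument
turns it into a multilinear identity for the operators `x ↦ a * x * b`
(`IsPI.exists_bimodule_identity`). By density, `n + 1` independent vectors in one component would
give shift operators of this type, whose products in all orders but one vanish, contradicting an
identity of degree `n` (`IsDenseCentroid.not_linearIndependent`). There are finitely many
components.

Let `K` be the algebraic closure of `C`. Density in finite dimension means that all `C`-linear
operators come from multiplications and projections, so `K ⊗ A` is still graded simple
(`IsDenseCentroid.isGradedSimple_baseChange`). A minimal graded left ideal yields an idempotent `e`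
for which `e B e` is a graded division algebra, hence a twisted group algebra over `K`. Dual systems
in `B e` and `e B` supply the matrix units (`IsGradedSimple.exists_equiv_matrix`).

Passing from `A` to `K ⊗ A` preserves the graded identities. In a homogeneous `C`-basis both
algebras have the same structure constants, so a polynomial evaluated at generic homogeneous
elements has the same coordinate polynomials in both. Since `C` and `K` are infinite, being an
identity means that these coordinates vanish. This is where the infinitude of `A` enters: over a
finite `C` it would be a finite set. -/

theorem prod_ofFn_sum {R : Type*} [Ring R] {m : ℕ} {ι : Type*} [Fintype ι]
    (z : Fin m → ι → R) :
    (List.ofFn fun k => ∑ j, z k j).prod = ∑ φ : Fin m → ι, (List.ofFn fun k => z k (φ k)).prod := by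
  classical
  have := (MultilinearMap.mkPiAlgebraFin ℤ m R).map_sum z
  simpa only [MultilinearMap.mkPiAlgebraFin_apply] using this

/-- Inclusion-exclusion: the alternating sum over the sets of deleted variables keeps exactly the
monomials in which all variables occur. -/
theorem alternating_sum_prod {R : Type*} [Ring R] {m d : ℕ} (z : Fin m → Fin d → R) :
    ∑ S : Finset (Fin d), (-1 : ℤ) ^ #S • (List.ofFn fun k => ∑ j, if j ∈ S then 0 else z k j).prod =
      ∑ φ : Fin m → Fin d,
        if Function.Surjective φ then (List.ofFn fun k => z k (φ k)).prod else 0 := by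
  classical
  have key : ∀ (S : Finset (Fin d)) (φ : Fin m → Fin d),
      (List.ofFn fun k => if φ k ∈ S then 0 else z k (φ k)).prod =
        if S ⊆ (univ.image φ)ᶜ then (List.ofFn fun k => z k (φ k)).prod else 0 := by
    intro S φ
    split_ifs with h
    · congr 2
      funext k
      rw [if_neg]
      intro hk
      simpa using h hk
    · apply List.prod_eq_zero
      simp only [subset_iff, mem_compl, mem_image, mem_univ, true_and, not_forall] at h
      obtain ⟨j, hj, h2⟩ := h
      obtain ⟨k, rfl⟩ := not_not.1 h2
      rw [List.mem_ofFn]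
      exact ⟨k, by simp [hj]⟩
  simp_rw [prod_ofFn_sum, key, smul_sum]
  rw [sum_comm]
  refine sum_congr rfl fun φ _ => ?_
  simp_rw [smul_ite, smul_zero]
  rw [← sum_filter, ← sum_smul]
  -- The monomial of `φ` survives deleting `S` exactly when `S` misses the image of `φ`. The signed
  -- count of such `S` is zero unless the image is everything.
  have : (univ.filter fun S : Finset (Fin d) => S ⊆ (univ.image φ)ᶜ) = (univ.image φ)ᶜ.powerset := by
    ext; simp
  rw [this, sum_powerset_neg_one_pow_card]
  have h : ((univ.image φ)ᶜ = ∅) ↔ Function.Surjective φ := by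
    rw [compl_eq_empty_iff, eq_univ_iff_forall]
    simp [Function.Surjective]
  simp only [h]
  split_ifs <;> simp

theorem sum_surjective_eq_sum_perm {M : Type*} [AddCommMonoid M] {d : ℕ}
    (f : (Fin d → Fin d) → M) :
    (∑ φ : Fin d → Fin d, if Function.Surjective φ then f φ else 0) =
      ∑ σ : Equiv.Perm (Fin d), f σ := by
  classical
  rw [← sum_filter]
  symm
  refine sum_bij (fun σ _ => (σ : Fin d → Fin d)) ?_ ?_ ?_ ?_
  · intro σ _
    simpa using σ.surjective
  · intro σ _ τ _ h
    exact DFunLike.coe_injective h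
  · intro φ hφ
    have hs : Function.Surjective φ := by simpa using hφ
    exact ⟨Equiv.ofBijective φ ⟨Finite.injective_iff_surjective.2 hs, hs⟩, mem_univ _, rfl⟩
  · intros; rfl

variable {F : Type*} {A : Type*} [Field F] [NonUnitalRing A]
  [Module F A] [IsScalarTower F A A] [SMulCommClass F A A]

theorem evalPoly_eq_sum {X : Type*} (a : X → A) (f : FreeAlgebra F X) :
    evalPoly F a f = (FreeAlgebra.equivMonoidAlgebraFreeMonoid f).coeff.sum fun w r =>
      r • (w.toList.map fun i => (Unitization.inr (a i) : Unitization F A)).prod := by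
  have h : FreeAlgebra.lift F (fun i => (Unitization.inr (a i) : Unitization F A)) =
      (MonoidAlgebra.lift F (Unitization F A) (FreeMonoid X)
        (FreeMonoid.lift fun i => (Unitization.inr (a i) : Unitization F A))).comp
        (FreeAlgebra.equivMonoidAlgebraFreeMonoid : FreeAlgebra F X ≃ₐ[F] _).toAlgHom := by
    ext i : 2
    simp [FreeAlgebra.equivMonoidAlgebraFreeMonoid]
  rw [evalPoly, h]
  simp only [AlgHom.comp_apply]
  erw [MonoidAlgebra.lift_apply]
  simp only [FreeMonoid.lift_apply]
  rfl

/-- Each variable `i` is replaced by the sum of the `y j` over the positions `j` with `u j = i`. The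
terms that survive inclusion-exclusion use every `y j`; as the word has length at most `d`, they use
each exactly once. Indexing by positions rather than by variables allows repeated letters without
dividing by factorials, so the characteristic plays no role. -/
theorem alternating_sum_word {d : ℕ} (u : Fin d → ℕ) (y : Fin d → A) (l : List ℕ)
    (hl : l.length ≤ d) :
    ∑ S : Finset (Fin d), (-1 : ℤ) ^ #S • (l.map fun i =>
        (Unitization.inr (∑ j, if j ∈ S then 0 else if u j = i then y j else 0) :
          Unitization F A)).prod =
      ∑ σ : Equiv.Perm (Fin d), if List.ofFn (u ∘ σ) = l then
        (List.ofFn fun k => (Unitization.inr (y (σ k)) : Unitization F A)).prod else 0 := by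
  classical
  have h1 : ∀ S : Finset (Fin d), (l.map fun i =>
        (Unitization.inr (∑ j, if j ∈ S then 0 else if u j = i then y j else 0) :
          Unitization F A)) = List.ofFn fun k : Fin l.length => ∑ j, if j ∈ S then 0 else
            if u j = l.get k then (Unitization.inr (y j) : Unitization F A) else 0 := by
    intro S
    conv_lhs => rw [← List.ofFn_get l, List.map_ofFn]
    congr 1
    funext k
    change Unitization.inrNonUnitalAlgHom F A _ = _
    rw [map_sum]
    refine sum_congr rfl fun j _ => ?_
    split_ifs <;> simp
  simp_rw [h1]
  rw [alternating_sum_prod (z := fun (k : Fin l.length) j =>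
    if u j = l.get k then (Unitization.inr (y j) : Unitization F A) else 0)]
  rcases hl.lt_or_eq with h | h
  · rw [sum_eq_zero, sum_eq_zero]
    · intro σ _
      rw [if_neg]
      rintro rfl
      simp at h
    · intro φ _
      rw [if_neg]
      intro hs
      have := Fintype.card_le_of_surjective φ hs
      simp at this
      omega
  · obtain ⟨v, rfl⟩ : ∃ v : Fin d → ℕ, l = List.ofFn v := by
      subst h
      exact ⟨l.get, (List.ofFn_get l).symm⟩
    have h2 : ∀ (m : ℕ) (hm : m = d) (z : Fin d → Fin d → Unitization F A),
        (∑ φ : Fin m → Fin d, if Function.Surjective φ then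
          (List.ofFn fun k => z (Fin.cast hm k) (φ k)).prod else 0) =
        ∑ σ : Equiv.Perm (Fin d), (List.ofFn fun k => z k (σ k)).prod := by
      rintro m rfl z
      exact sum_surjective_eq_sum_perm fun φ => (List.ofFn fun k => z k (φ k)).prod
    have h3 := h2 _ h fun k j => if u j = v k then (Unitization.inr (y j) : Unitization F A) else 0
    simp only [List.get_ofFn]
    rw [h3]
    refine sum_congr rfl fun σ _ => ?_
    split_ifs with hσ
    · have := List.ofFn_injective hσ
      congr 2
      funext k
      exact if_pos (congrFun this k)
    · apply List.prod_eq_zero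
      rw [List.mem_ofFn]
      by_contra hne
      apply hσ
      congr 1
      funext k
      by_contra hk
      exact hne ⟨k, by simpa using fun h => absurd h hk⟩

variable (F A) in
/-- The multilinear polynomial `∑ σ, c σ x_{σ 1} ⋯ x_{σ d}` is an identity of `A`. -/
def IsMultilinearIdentity {d : ℕ} (c : Equiv.Perm (Fin d) → F) : Prop :=
  ∀ y : Fin d → A, ∑ σ, c σ •
    (List.ofFn fun k => (Unitization.inr (y (σ k)) : Unitization F A)).prod = 0

/-- Linearize at a word `w` of maximal length in the support: shorter monomials disappear, and those
of equal length contribute only if they rearrange `w`. Dividing by the coefficient of `w` normalizes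
the identity permutation. -/
theorem IsPI.exists_multilinear (h : IsPI F A) :
    ∃ (d : ℕ) (c : Equiv.Perm (Fin d) → F), c 1 = 1 ∧ IsMultilinearIdentity F A c := by
  classical
  obtain ⟨f, hf, hA⟩ := h
  set p := (FreeAlgebra.equivMonoidAlgebraFreeMonoid f).coeff with hp
  have hp0 : p ≠ 0 := by
    intro h0
    apply hf
    apply (FreeAlgebra.equivMonoidAlgebraFreeMonoid (R := F) (X := ℕ)).injective
    rw [map_zero]
    ext w
    exact DFunLike.congr_fun h0 w
  obtain ⟨w, hw, hmax⟩ := exists_max_image p.support (fun w => w.toList.length)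
    (Finsupp.support_nonempty_iff.2 hp0)
  set u : Fin w.toList.length → ℕ := w.toList.get with hu
  have hpw : p w ≠ 0 := Finsupp.mem_support_iff.1 hw
  refine ⟨w.toList.length, fun σ => (p w)⁻¹ * p (FreeMonoid.ofList (List.ofFn (u ∘ σ))), ?_, ?_⟩
  · have : List.ofFn (u ∘ (1 : Equiv.Perm (Fin w.toList.length))) = w.toList := by
      simp [hu]
    beta_reduce
    rw [this, FreeMonoid.ofList_toList, inv_mul_cancel₀ hpw]
  · intro y
    have key : ∑ S : Finset (Fin w.toList.length), (-1 : ℤ) ^ #S • evalPoly F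
        (fun i => ∑ j, if j ∈ S then 0 else if u j = i then y j else 0) f = 0 := by
      simp [hA]
    simp_rw [evalPoly_eq_sum, ← hp, Finsupp.sum, smul_sum] at key
    rw [sum_comm] at key
    simp_rw [smul_comm _ (p _), ← smul_sum] at key
    rw [sum_congr rfl fun x hx => by rw [alternating_sum_word u y _ (hmax x hx)]] at key
    simp_rw [smul_sum] at key
    rw [sum_comm] at key
    simp_rw [mul_smul, ← smul_sum]
    rw [← smul_zero ((p w)⁻¹), ← key]
    congr 1
    refine sum_congr rfl fun σ _ => ?_
    rw [sum_eq_single (FreeMonoid.ofList (List.ofFn (u ∘ σ)))]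
    · simp
    · intro x _ hx
      rw [if_neg, smul_zero]
      intro h
      exact hx (by rw [h, FreeMonoid.ofList_toList])
    · intro hx
      rw [Finsupp.notMem_support_iff.1 hx, zero_smul]

end Linearization

/-! ### Good words and Regev's identity for two-sided multiplications. -/

section Words

open Finset

/-- Cut `u` before each chosen letter; what precedes the first one goes into `w`. -/
theorem _root_.List.Sublist.exists_blocks {X : Type*} {l u : List X} (h : l.Sublist u) :
    ∃ (w : List X) (L : List (List X)), u = w ++ L.flatten ∧ L.map List.head? = l.map some := by
  induction h with
  | slnil => exact ⟨[], [], rfl, rfl⟩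
  | cons a _ ih =>
    obtain ⟨w, L, rfl, h⟩ := ih
    exact ⟨a :: w, L, rfl, h⟩
  | cons_cons a _ ih =>
    obtain ⟨w, L, rfl, h⟩ := ih
    exact ⟨[], (a :: w) :: L, rfl, by simp [h]⟩

/-- At the first place where the two lists of blocks differ, the new block is one that stood later
in `L`, so it begins with a smaller letter. -/
theorem flatten_lt_flatten_of_perm {X : Type*} [LinearOrder X] {l : List X} (hl : l.Pairwise (· > ·))
    {L L' : List (List X)} (hL : L.map List.head? = l.map some) (hp : L'.Perm L) (hne : L' ≠ L) :
    L'.flatten < L.flatten := by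
  induction l generalizing L L' with
  | nil =>
    simp only [List.map_nil, List.map_eq_nil_iff] at hL
    subst hL
    exact absurd hp.eq_nil hne
  | cons x l ih =>
    obtain _ | ⟨B, Q⟩ := L
    · simp at hL
    obtain _ | ⟨B', Q'⟩ := L'
    · simpa using hp.length_eq
    simp only [List.map_cons, List.cons.injEq] at hL
    rw [List.pairwise_cons] at hl
    simp only [List.flatten_cons]
    obtain _ | ⟨b, B⟩ := B
    · simp at hL
    obtain rfl : b = x := by simpa using hL.1
    by_cases hB : B' = b :: B
    · subst hB
      have := ih hl.2 hL.2 (List.perm_cons _ |>.1 hp) (by simpa using hne)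
      exact List.append_left_lt this
    · have hmem : B' ∈ Q := by
        have : B' ∈ (b :: B) :: Q := hp.subset List.mem_cons_self
        simpa [hB] using this
      have h2 : B'.head? ∈ l.map some := hL.2 ▸ List.mem_map_of_mem hmem
      obtain ⟨b', hb', h3⟩ := List.mem_map.1 h2
      obtain _ | ⟨b'', B'⟩ := B'
      · simp at h3
      obtain rfl : b' = b'' := by simpa using h3
      rw [List.cons_append, List.cons_append, List.cons_lt_cons_iff]
      exact Or.inl (hl.1 b' hb')

/-- A word is `d`-good if it has no strictly decreasing subword of length `d`. -/
def IsGoodWord {X : Type*} [LinearOrder X] (d : ℕ) (u : List X) : Prop :=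
  ∀ l : List X, l.Sublist u → l.Pairwise (· > ·) → l.length ≠ d

variable {F : Type*} {A : Type*} [Field F] [NonUnitalRing A]
  [Module F A] [IsScalarTower F A A] [SMulCommClass F A A]

variable (F A) in
/-- The monomial function given by a word. -/
def wordMap {X : Type*} (u : List X) (a : X → A) : Unitization F A :=
  (u.map fun i => (Unitization.inr (a i) : Unitization F A)).prod

theorem wordMap_append {X : Type*} (u v : List X) (a : X → A) :
    wordMap F A (u ++ v) a = wordMap F A u a * wordMap F A v a := by
  simp [wordMap]

theorem wordMap_flatten {X : Type*} (L : List (List X)) (a : X → A) :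
    wordMap F A L.flatten a = (L.map fun u => wordMap F A u a).prod := by
  induction L with
  | nil => simp [wordMap]
  | cons u L ih => simp [wordMap_append, ih]

omit [IsScalarTower F A A] [SMulCommClass F A A] in
theorem exists_inr_eq_wordMap {X : Type*} {u : List X} (hu : u ≠ []) (a : X → A) :
    ∃ y : A, (Unitization.inr y : Unitization F A) = wordMap F A u a := by
  induction u with
  | nil => exact absurd rfl hu
  | cons x u ih =>
    by_cases h : u = []
    · subst h
      exact ⟨a x, by simp [wordMap]⟩
    · obtain ⟨y, hy⟩ := ih h
      refine ⟨a x * y, ?_⟩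
      rw [Unitization.inr_mul, hy]
      simp [wordMap]

theorem IsMultilinearIdentity.wordMap_eq {d : ℕ} {c : Equiv.Perm (Fin d) → F} (h1 : c 1 = 1)
    (hc : IsMultilinearIdentity F A c) {X : Type*} (w : List X) (B : Fin d → List X)
    (hB : ∀ k, B k ≠ []) :
    wordMap F A (w ++ (List.ofFn B).flatten) =
      ∑ σ ∈ univ.erase (1 : Equiv.Perm (Fin d)),
        (-c σ) • wordMap F A (w ++ (List.ofFn (B ∘ σ)).flatten) := by
  funext a
  choose y hy using fun k => exists_inr_eq_wordMap (F := F) (hB k) a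
  have h := hc y
  simp_rw [hy] at h
  have h2 : ∀ σ : Equiv.Perm (Fin d), (List.ofFn fun k => wordMap F A (B (σ k)) a).prod =
      wordMap F A (List.ofFn (B ∘ σ)).flatten a := by
    intro σ
    rw [wordMap_flatten, List.map_ofFn]
    rfl
  simp_rw [h2] at h
  rw [← add_sum_erase _ _ (mem_univ 1), h1, one_smul] at h
  rw [Finset.sum_apply]
  simp only [Pi.smul_apply, wordMap_append, neg_smul, sum_neg_distrib]
  simp_rw [← mul_smul_comm]
  rw [← mul_sum, ← mul_neg, ← eq_neg_of_add_eq_zero_left h]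
  rfl

/-- A word that is not good splits as a prefix followed by `d` blocks with decreasing initial
letters. The multilinear identity rewrites it through nontrivial permutations of the blocks, all of
them lexicographically smaller. -/
theorem wordMap_mem_span_good {d : ℕ} {c : Equiv.Perm (Fin d) → F} (h1 : c 1 = 1)
    (hc : IsMultilinearIdentity F A c) {X : Type*} [LinearOrder X] (u : List X) :
    wordMap F A u ∈ Submodule.span F (wordMap F A '' {v | v.Perm u ∧ IsGoodWord d v}) := by
  -- The lexicographic order on words is not well founded in general, but the rewriting never leaves
  -- the finite set of rearrangements of `u`.
  have hfin : {v : List X | v.Perm u}.Finite :=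
    (u.permutations.finite_toSet).subset fun v hv => List.mem_permutations.2 hv
  refine (hfin.wellFoundedOn (r := (· < ·))).induction (x := u) (List.Perm.refl u)
    (P := fun v => wordMap F A v ∈
      Submodule.span F (wordMap F A '' {v | v.Perm u ∧ IsGoodWord d v})) ?_
  intro v hv ih
  by_cases hg : IsGoodWord d v
  · exact Submodule.subset_span ⟨v, ⟨hv, hg⟩, rfl⟩
  unfold IsGoodWord at hg
  push Not at hg
  obtain ⟨l, hlv, hl, rfl⟩ := hg
  obtain ⟨w, L, rfl, hL⟩ := hlv.exists_blocks
  have hlen : L.length = l.length := by simpa using congrArg List.length hL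
  obtain ⟨B, rfl⟩ : ∃ B : Fin l.length → List X, L = List.ofFn B :=
    ⟨fun k => L.get (k.cast hlen.symm), by
      rw [← List.ofFn_congr hlen L.get, List.ofFn_get]⟩
  have hB : ∀ k, (B k).head? = some (l.get k) := by
    intro k
    rw [List.map_ofFn] at hL
    have : List.ofFn (List.head? ∘ B) = List.ofFn (some ∘ l.get) := by
      rw [hL, ← List.map_ofFn, List.ofFn_get]
    exact congrFun (List.ofFn_injective this) k
  have hinj : Function.Injective B := by
    intro i j hij
    have h := hB i
    rw [hij, hB j] at h
    have hnd : l.Nodup := hl.imp fun h => ne_of_gt h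
    exact (List.nodup_iff_injective_get.1 hnd (Option.some.inj h)).symm
  rw [hc.wordMap_eq h1 w B fun k hk => by simpa [hk] using hB k]
  refine Submodule.sum_mem _ fun σ hσ => Submodule.smul_mem _ _ (ih _ ?_ ?_)
  · refine List.Perm.trans (List.Perm.append_left w ?_) hv
    exact (σ.ofFn_comp_perm B).flatten
  · refine List.append_left_lt (flatten_lt_flatten_of_perm hl hL (σ.ofFn_comp_perm B) ?_)
    intro h
    apply (mem_erase.1 hσ).1
    ext k : 1
    exact hinj (congrFun (List.ofFn_injective h) k)

/-- Label a position by the length of the longest strictly decreasing chain ending there; goodness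
keeps this below `d`. -/
theorem exists_label {n d : ℕ} {Y : Type*} [LinearOrder Y] {f : Fin n → Y}
    (hf : IsGoodWord d (List.ofFn f)) :
    ∃ ℓ : Fin n → Fin d, ∀ i j, i < j → f j < f i → ℓ i < ℓ j := by
  classical
  have hcard : ∀ t : Finset (Fin n), StrictAntiOn f t → #t < d := by
    intro t ht
    by_contra! hd
    obtain ⟨s, hst, hs⟩ := exists_subset_card_eq hd
    refine hf (((List.finRange n).filter (· ∈ s)).map f) ?_ ?_ ?_
    · rw [List.ofFn_eq_map]
      exact List.Sublist.map f List.filter_sublist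
    · rw [List.pairwise_map]
      refine List.Pairwise.imp_of_mem ?_ ((List.pairwise_lt_finRange n).filter _)
      intro a b ha hb hab
      simp only [List.mem_filter, List.mem_finRange, true_and, decide_eq_true_eq] at ha hb
      exact ht (hst ha) (hst hb) hab
    · rw [List.length_map, ← hs]
      rw [← List.toFinset_card_of_nodup ((List.nodup_finRange n).filter _)]
      congr 1
      ext; simp
  let T : Fin n → Finset (Finset (Fin n)) := fun i =>
    univ.filter fun t => StrictAntiOn f t ∧ i ∈ t ∧ ∀ j ∈ t, j ≤ i
  have hT : ∀ i, (T i).Nonempty := fun i => ⟨{i}, by simp [T]⟩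
  choose t ht hmax using fun i => exists_max_image (T i) (fun t => #t) (hT i)
  refine ⟨fun i => ⟨#(t i), hcard _ (by have := ht i; simp only [T, mem_filter] at this; exact this.2.1)⟩,
    fun i j hij hf => ?_⟩
  have hti : StrictAntiOn f (t i) ∧ i ∈ t i ∧ ∀ j ∈ t i, j ≤ i := by
    have := ht i
    simpa [T] using this
  have hj : j ∉ t i := fun h => absurd (hti.2.2 j h) (not_le.2 hij)
  have : insert j (t i) ∈ T j := by
    simp only [T, mem_filter, mem_univ, true_and, mem_insert, true_or, forall_eq_or_imp, le_refl]
    refine ⟨?_, fun k hk => (hti.2.2 k hk).trans hij.le⟩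
    intro a ha b hb hab
    simp only [coe_insert, Set.mem_insert_iff, mem_coe] at ha hb
    rcases ha with rfl | ha <;> rcases hb with rfl | hb
    · exact absurd hab (lt_irrefl _)
    · exact absurd (hab.trans_le ((hti.2.2 b hb).trans hij.le)) (lt_irrefl _)
    · rcases (hti.2.2 a ha).eq_or_lt with rfl | h
      · exact hf
      · exact hf.trans (hti.1 ha hti.2.1 h)
    · exact hti.1 ha hb hab
  have := hmax j _ this
  rw [card_insert_of_notMem hj] at this
  exact Nat.lt_of_succ_le this

open Classical in
-- A good permutation increases on each label class of positions, so it is determined by the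
-- labelling of positions together with the induced labelling of values.
theorem card_good_perm_le (n d : ℕ) :
    Fintype.card {σ : Equiv.Perm (Fin n) // IsGoodWord d (List.ofFn σ)} ≤ d ^ n * d ^ n := by
  choose ℓ hℓ using fun σ : {σ : Equiv.Perm (Fin n) // IsGoodWord d (List.ofFn σ)} =>
    exists_label σ.2
  have hmono : ∀ σ, ∀ i j, ℓ σ i = ℓ σ j → i < j → σ.1 i < σ.1 j := by
    intro σ i j h hij
    rcases lt_trichotomy (σ.1 i) (σ.1 j) with h1 | h1 | h1
    · exact h1
    · exact absurd (σ.1.injective h1) hij.ne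
    · exact absurd h (hℓ σ i j hij h1).ne
  have key : ∀ σ τ : {σ : Equiv.Perm (Fin n) // IsGoodWord d (List.ofFn σ)},
      ℓ σ = ℓ τ → ℓ σ ∘ σ.1.symm = ℓ τ ∘ τ.1.symm → ∀ i, i ≤ τ.1.symm (σ.1 i) := by
    intro σ τ h1 h2 i
    have hρ : ∀ j, ℓ τ (τ.1.symm (σ.1 j)) = ℓ τ j := by
      intro j
      have := congrFun h2 (σ.1 j)
      simp only [Function.comp_apply, Equiv.symm_apply_apply] at this
      rw [← this, h1]
    -- Equal labellings make `τ⁻¹ σ` preserve each class and increase on it; a strictly increasing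
    -- self-map of a finite chain never moves a point down. Exchanging `σ` and `τ` will give
    -- equality.
    let g : {j // ℓ τ j = ℓ τ i} → {j // ℓ τ j = ℓ τ i} := fun j =>
      ⟨τ.1.symm (σ.1 j), (hρ j).trans j.2⟩
    have hg : StrictMono g := by
      intro a b hab
      have h3 : σ.1 a < σ.1 b := hmono σ a b (by rw [h1, a.2, b.2]) hab
      by_contra! hle
      have hle : τ.1.symm (σ.1 b) ≤ τ.1.symm (σ.1 a) := hle
      rcases hle.eq_or_lt with h4 | h4
      · exact absurd (τ.1.symm.injective h4) h3.ne'
      · have := hmono τ _ _ (by rw [hρ, hρ, a.2, b.2]) h4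
        simp only [Equiv.apply_symm_apply] at this
        exact absurd this h3.asymm
    exact hg.le_apply (x := ⟨i, rfl⟩)
  have hinj : Function.Injective fun σ : {σ : Equiv.Perm (Fin n) // IsGoodWord d (List.ofFn σ)} =>
      (ℓ σ, ℓ σ ∘ σ.1.symm) := by
    intro σ τ h
    simp only [Prod.mk.injEq] at h
    ext i : 3
    apply le_antisymm
    · by_contra! hlt
      have h1 := key σ τ h.1 h.2 i
      have h2 := key τ σ h.1.symm h.2.symm (τ.1.symm (σ.1 i))
      simp only [Equiv.apply_symm_apply, Equiv.symm_apply_apply] at h2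
      have h3 := le_antisymm h1 h2
      rw [Equiv.eq_symm_apply] at h3
      exact absurd (congrArg Fin.val h3) hlt.ne
    · have h1 := key σ τ h.1 h.2 i
      have h2 := key τ σ h.1.symm h.2.symm (τ.1.symm (σ.1 i))
      simp only [Equiv.apply_symm_apply, Equiv.symm_apply_apply] at h2
      have h3 := le_antisymm h1 h2
      rw [Equiv.eq_symm_apply] at h3
      exact h3.le
  simpa using Fintype.card_le_of_injective _ hinj

theorem exists_perm_of_perm_ofFn {n : ℕ} {σ : Equiv.Perm (Fin n)} {v : List (Fin n)}
    (h : v.Perm (List.ofFn σ)) : ∃ τ : Equiv.Perm (Fin n), v = List.ofFn τ := by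
  have hlen : v.length = n := by simpa using h.length_eq
  obtain ⟨g, rfl⟩ : ∃ g : Fin n → Fin n, v = List.ofFn g :=
    ⟨fun k => v.get (k.cast hlen.symm), by rw [← List.ofFn_congr hlen v.get, List.ofFn_get]⟩
  have hnd : (List.ofFn g).Nodup := h.nodup_iff.2 (List.nodup_ofFn.2 σ.injective)
  have hinj := List.nodup_ofFn.1 hnd
  exact ⟨Equiv.ofBijective g ⟨hinj, Finite.injective_iff_surjective.1 hinj⟩, rfl⟩

/-- A PI algebra `A` satisfies a nontrivial multilinear identity for `A ⊗ Aᵒᵖ`. -/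
theorem IsPI.exists_bimodule_identity (h : IsPI F A) :
    ∃ (n : ℕ) (c : Equiv.Perm (Fin n) → F), c ≠ 0 ∧
      ∀ (a b : Fin n → A) (x : Unitization F A),
        ∑ σ : Equiv.Perm (Fin n), c σ • (wordMap F A (List.ofFn σ) a * x *
          wordMap F A (List.ofFn (Fin.revPerm.trans σ)) b) = 0 := by
  classical
  obtain ⟨d, c, h1, hc⟩ := h.exists_multilinear
  -- There are `n!` unknown coefficients, against one linear condition for each pair of good
  -- permutations. Factorial growth beats `(d ^ 4) ^ n`.
  obtain ⟨n, hn⟩ : ∃ n : ℕ, (d ^ n * d ^ n) * (d ^ n * d ^ n) < n.factorial := by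
    have h := FloorSemiring.tendsto_pow_div_factorial_atTop ((d : ℝ) ^ 4)
    obtain ⟨n, hn⟩ := (h.eventually_lt_const (zero_lt_one)).exists
    refine ⟨n, ?_⟩
    rw [div_lt_one (by positivity)] at hn
    have h2 : (d ^ n * d ^ n) * (d ^ n * d ^ n) = (d ^ 4) ^ n := by ring
    rw [h2]
    exact_mod_cast hn
  let Γ := {σ : Equiv.Perm (Fin n) // IsGoodWord d (List.ofFn σ)}
  have hspan : ∀ σ : Equiv.Perm (Fin n), ∃ l : Γ → F,
      ∑ τ, l τ • wordMap F A (List.ofFn τ.1) = wordMap F A (List.ofFn σ) := by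
    intro σ
    rw [← Submodule.mem_span_range_iff_exists_fun]
    refine Submodule.span_mono ?_ (wordMap_mem_span_good h1 hc (List.ofFn σ))
    rintro _ ⟨v, ⟨hv, hg⟩, rfl⟩
    obtain ⟨τ, rfl⟩ := exists_perm_of_perm_ofFn hv
    exact ⟨⟨τ, hg⟩, rfl⟩
  choose l hl using hspan
  -- Expand the word of `σ` and its reversal in good words; a kernel vector makes the coefficient of
  -- every pair of good words vanish.
  let Φ : (Equiv.Perm (Fin n) → F) →ₗ[F] (Γ × Γ → F) :=
    LinearMap.pi fun p => ∑ σ : Equiv.Perm (Fin n), (l σ p.1 * l (Fin.revPerm.trans σ) p.2) • LinearMap.proj σ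
  have hker : LinearMap.ker Φ ≠ ⊥ := by
    apply LinearMap.ker_ne_bot_of_finrank_lt
    rw [Module.finrank_fintype_fun_eq_card, Module.finrank_fintype_fun_eq_card, Fintype.card_prod,
      Fintype.card_perm, Fintype.card_fin]
    exact (Nat.mul_le_mul (card_good_perm_le n d) (card_good_perm_le n d)).trans_lt hn
  obtain ⟨e, he, he0⟩ := Submodule.exists_mem_ne_zero_of_ne_bot hker
  refine ⟨n, e, he0, fun a b x => ?_⟩
  have he' : ∀ τ τ' : Γ, ∑ σ, e σ * (l σ τ * l (Fin.revPerm.trans σ) τ') = 0 := by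
    intro τ τ'
    have := congrFun (LinearMap.mem_ker.1 he) (τ, τ')
    simpa [Φ, mul_comm] using this
  have h3 : ∀ σ : Equiv.Perm (Fin n), wordMap F A (List.ofFn σ) a * x *
      wordMap F A (List.ofFn (Fin.revPerm.trans σ)) b = ∑ τ : Γ, ∑ τ' : Γ,
        (l σ τ * l (Fin.revPerm.trans σ) τ') •
          (wordMap F A (List.ofFn τ.1) a * x * wordMap F A (List.ofFn τ'.1) b) := by
    intro σ
    rw [← hl σ, ← hl (Fin.revPerm.trans σ), Finset.sum_apply, Finset.sum_apply, sum_mul, sum_mul_sum]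
    refine sum_congr rfl fun τ _ => sum_congr rfl fun τ' _ => ?_
    simp only [Pi.smul_apply, smul_mul_assoc, mul_smul_comm, smul_smul]
    rw [mul_comm]
  simp_rw [h3, smul_sum, smul_smul]
  rw [sum_comm]
  refine sum_eq_zero fun τ _ => ?_
  rw [sum_comm]
  refine sum_eq_zero fun τ' _ => ?_
  rw [← sum_smul, he', zero_smul]

end Words

/-! ### Homogeneous projections and ideals of a graded simple algebra. -/

section Projections

variable {F : Type*} {G : Type*} {A : Type*} [Field F] [Group G] [NonUnitalRing A] [Module F A]
  {𝒜 : G → Submodule F A}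

open Classical in
theorem IsGrading.bijective_coeLinearMap (h : IsGrading 𝒜) :
    Function.Bijective (DirectSum.coeLinearMap 𝒜) :=
  DirectSum.isInternal_submodule_of_iSupIndep_of_iSup_eq_top h.indep h.iSup_eq_top

open Classical in
/-- The projection onto the component of degree `g`. -/
def IsGrading.proj (h : IsGrading 𝒜) (g : G) : A →ₗ[F] A :=
  (𝒜 g).subtype ∘ₗ DirectSum.component F G (fun g => 𝒜 g) g ∘ₗ
    (LinearEquiv.ofBijective (DirectSum.coeLinearMap 𝒜) h.bijective_coeLinearMap).symm.toLinearMap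

variable (h : IsGrading 𝒜)
include h

theorem IsGrading.proj_mem (g : G) (a : A) : h.proj g a ∈ 𝒜 g :=
  Subtype.property _

open Classical in
theorem IsGrading.proj_eq_ite {g k : G} {a : A} (ha : a ∈ 𝒜 g) :
    h.proj k a = if g = k then a else 0 := by
  have : (LinearEquiv.ofBijective (DirectSum.coeLinearMap 𝒜) h.bijective_coeLinearMap).symm a =
      DirectSum.lof F G (fun g => 𝒜 g) g ⟨a, ha⟩ := by
    rw [LinearEquiv.symm_apply_eq, LinearEquiv.ofBijective_apply, DirectSum.coeLinearMap_lof]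
  rw [IsGrading.proj]
  simp only [LinearMap.comp_apply, LinearEquiv.coe_coe]
  rw [this, DirectSum.component.of]
  split_ifs with hgk
  · subst hgk; rfl
  · rfl

theorem IsGrading.proj_of_mem {g : G} {a : A} (ha : a ∈ 𝒜 g) : h.proj g a = a := by
  classical
  rw [h.proj_eq_ite ha, if_pos rfl]

theorem IsGrading.proj_of_ne {g k : G} {a : A} (ha : a ∈ 𝒜 g) (hk : g ≠ k) : h.proj k a = 0 := by
  classical
  rw [h.proj_eq_ite ha, if_neg hk]

@[elab_as_elim]
theorem IsGrading.induction {p : A → Prop} (a : A) (hom : ∀ g, ∀ x ∈ 𝒜 g, p x)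
    (zero : p 0) (add : ∀ x y, p x → p y → p (x + y)) : p a := by
  have : a ∈ ⨆ g, 𝒜 g := h.iSup_eq_top ▸ Submodule.mem_top
  exact Submodule.iSup_induction 𝒜 (motive := p) this hom zero add

theorem IsGrading.sum_proj [Fintype G] (a : A) : ∑ g, h.proj g a = a := by
  classical
  induction a using h.induction with
  | hom g x hx => simp [h.proj_eq_ite hx]
  | zero => simp
  | add x y hx hy => simp [Finset.sum_add_distrib, hx, hy]

theorem IsGrading.eq_zero_of_proj [Finite G] {a : A} (ha : ∀ g, h.proj g a = 0) : a = 0 := by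
  cases nonempty_fintype G
  rw [← h.sum_proj a]
  simp [ha]

theorem IsGrading.exists_proj_ne_zero [Finite G] {a : A} (ha : a ≠ 0) : ∃ g, h.proj g a ≠ 0 := by
  by_contra! hc
  exact ha (h.eq_zero_of_proj hc)

theorem IsGrading.proj_mul_left {g : G} {a : A} (ha : a ∈ 𝒜 g) (k : G) (b : A) :
    h.proj k (a * b) = a * h.proj (g⁻¹ * k) b := by
  classical
  induction b using h.induction with
  | hom l x hx =>
    rw [h.proj_eq_ite hx, h.proj_eq_ite (h.mul_mem ha hx), mul_ite, mul_zero]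
    simp only [eq_inv_mul_iff_mul_eq]
  | zero => simp
  | add x y hx hy => simp [mul_add, hx, hy]

theorem IsGrading.proj_mul_right {g : G} {a : A} (ha : a ∈ 𝒜 g) (k : G) (b : A) :
    h.proj k (b * a) = h.proj (k * g⁻¹) b * a := by
  classical
  induction b using h.induction with
  | hom l x hx =>
    rw [h.proj_eq_ite hx, h.proj_eq_ite (h.mul_mem hx ha), ite_mul, zero_mul]
    simp only [eq_mul_inv_iff_mul_eq]
  | zero => simp
  | add x y hx hy => simp [add_mul, hx, hy]

theorem IsGrading.isGradedIdeal [Finite G] {I : Submodule F A}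
    (hl : ∀ (a : A) {x : A}, x ∈ I → a * x ∈ I) (hr : ∀ (a : A) {x : A}, x ∈ I → x * a ∈ I)
    (hp : ∀ g, ∀ x ∈ I, h.proj g x ∈ I) : IsGradedIdeal 𝒜 I where
  mul_mem_left := hl
  mul_mem_right := hr
  graded := by
    cases nonempty_fintype G
    apply le_antisymm
    · intro x hx
      rw [← h.sum_proj x]
      exact Submodule.sum_mem _ fun g _ =>
        Submodule.mem_iSup_of_mem g ⟨hp g x hx, h.proj_mem g x⟩
    · exact iSup_le fun g => inf_le_left

theorem IsGrading.proj_mem_span {S : Set A} (hS : ∀ x ∈ S, ∃ g, x ∈ 𝒜 g) {x : A}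
    (hx : x ∈ Submodule.span F S) (k : G) : h.proj k x ∈ Submodule.span F S := by
  classical
  induction hx using Submodule.span_induction with
  | mem x hx =>
    obtain ⟨g, hg⟩ := hS x hx
    rw [h.proj_eq_ite hg]
    split_ifs
    · exact Submodule.subset_span hx
    · exact Submodule.zero_mem _
  | zero => simp
  | add x y _ _ hx hy => rw [map_add]; exact Submodule.add_mem _ hx hy
  | smul c x _ hx => rw [map_smul]; exact Submodule.smul_mem _ c hx

variable (hs : IsGradedSimple 𝒜)
include hs

/-- The elements killed by all left multiplications form a graded ideal, which is proper since `A² ≠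
0`. -/
theorem IsGradedSimple.eq_zero_of_mul_left [SMulCommClass F A A] [Finite G] {x : A} (hx : ∀ a, a * x = 0) : x = 0 := by
  let I : Submodule F A :=
    { carrier := {x | ∀ a, a * x = 0}
      add_mem' := fun hx hy a => by rw [mul_add, hx a, hy a, add_zero]
      zero_mem' := fun a => mul_zero a
      smul_mem' := fun c x hx a => by rw [mul_smul_comm, hx a, smul_zero] }
  have hI : IsGradedIdeal 𝒜 I := by
    refine h.isGradedIdeal ?_ ?_ ?_
    · intro b x hx a
      rw [← mul_assoc]; exact hx _
    · intro b x hx a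
      rw [← mul_assoc, hx a, zero_mul]
    · intro g x hx a
      induction a using h.induction with
      | hom k a ha =>
        have := h.proj_mul_left ha (k * g) x
        rw [hx a, map_zero, inv_mul_cancel_left] at this
        exact this.symm
      | zero => exact zero_mul _
      | add a b ha hb => rw [add_mul, ha, hb, add_zero]
  rcases hs.eq_bot_or_eq_top I hI with h0 | h0
  · exact (Submodule.mem_bot F).1 (h0 ▸ (show x ∈ I from hx))
  · obtain ⟨a, b, hab⟩ := hs.sq_ne_zero
    exact absurd ((h0 ▸ Submodule.mem_top : b ∈ I) a) hab

theorem IsGradedSimple.eq_zero_of_mul_right [IsScalarTower F A A] [Finite G] {x : A} (hx : ∀ a, x * a = 0) : x = 0 := by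
  let I : Submodule F A :=
    { carrier := {x | ∀ a, x * a = 0}
      add_mem' := fun hx hy a => by rw [add_mul, hx a, hy a, add_zero]
      zero_mem' := fun a => zero_mul a
      smul_mem' := fun c x hx a => by rw [smul_mul_assoc, hx a, smul_zero] }
  have hI : IsGradedIdeal 𝒜 I := by
    refine h.isGradedIdeal ?_ ?_ ?_
    · intro b x hx a
      rw [mul_assoc, hx a, mul_zero]
    · intro b x hx a
      rw [mul_assoc]; exact hx _
    · intro g x hx a
      induction a using h.induction with
      | hom k a ha =>
        have := h.proj_mul_right ha (g * k) x
        rw [hx a, map_zero, mul_inv_cancel_right] at this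
        exact this.symm
      | zero => exact mul_zero _
      | add a b ha hb => rw [mul_add, ha, hb, add_zero]
  rcases hs.eq_bot_or_eq_top I hI with h0 | h0
  · exact (Submodule.mem_bot F).1 (h0 ▸ (show x ∈ I from hx))
  · obtain ⟨a, b, hab⟩ := hs.sq_ne_zero
    exact absurd ((h0 ▸ Submodule.mem_top : a ∈ I) b) hab

/-- Since `x` is homogeneous, `a` and `b` can be taken homogeneous, so the span is a graded ideal;
it is nonzero because the annihilators vanish. This substitutes for the ideal generated by `x` when
there is no unit. -/
theorem IsGradedSimple.span_mul_mul [IsScalarTower F A A] [SMulCommClass F A A] [Finite G] {g : G} {x : A} (hx : x ∈ 𝒜 g) (hx0 : x ≠ 0) :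
    Submodule.span F {y | ∃ a b : A, y = a * x * b} = ⊤ := by
  have hle : ∀ a b : A, a * x * b ∈ Submodule.span F
      {y | ∃ k l, ∃ a ∈ 𝒜 k, ∃ b ∈ 𝒜 l, y = a * x * b} := by
    intro a b
    induction a using h.induction with
    | hom k a ha =>
      induction b using h.induction with
      | hom l b hb => exact Submodule.subset_span ⟨k, l, a, ha, b, hb, rfl⟩
      | zero => rw [mul_zero]; exact Submodule.zero_mem _
      | add b c hb hc => rw [mul_add]; exact Submodule.add_mem _ hb hc
    | zero => rw [zero_mul, zero_mul]; exact Submodule.zero_mem _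
    | add a c ha hc => rw [add_mul, add_mul]; exact Submodule.add_mem _ ha hc
  have heq : Submodule.span F {y | ∃ a b : A, y = a * x * b} = Submodule.span F
      {y | ∃ k l, ∃ a ∈ 𝒜 k, ∃ b ∈ 𝒜 l, y = a * x * b} := by
    apply le_antisymm
    · rw [Submodule.span_le]
      rintro _ ⟨a, b, rfl⟩
      exact hle a b
    · apply Submodule.span_mono
      rintro _ ⟨_, _, a, _, b, _, rfl⟩
      exact ⟨a, b, rfl⟩
  have hI : IsGradedIdeal 𝒜 (Submodule.span F {y | ∃ a b : A, y = a * x * b}) := by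
    refine h.isGradedIdeal ?_ ?_ ?_
    · intro a y hy
      induction hy using Submodule.span_induction with
      | mem y hy =>
        obtain ⟨b, c, rfl⟩ := hy
        exact Submodule.subset_span ⟨a * b, c, by simp only [mul_assoc]⟩
      | zero => simp
      | add y z _ _ hy hz => rw [mul_add]; exact Submodule.add_mem _ hy hz
      | smul c y _ hy => rw [mul_smul_comm]; exact Submodule.smul_mem _ c hy
    · intro a y hy
      induction hy using Submodule.span_induction with
      | mem y hy =>
        obtain ⟨b, c, rfl⟩ := hy
        exact Submodule.subset_span ⟨b, c * a, by simp only [mul_assoc]⟩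
      | zero => simp
      | add y z _ _ hy hz => rw [add_mul]; exact Submodule.add_mem _ hy hz
      | smul c y _ hy => rw [smul_mul_assoc]; exact Submodule.smul_mem _ c hy
    · intro k y hy
      rw [heq] at hy ⊢
      refine h.proj_mem_span ?_ hy k
      rintro _ ⟨k, l, a, ha, b, hb, rfl⟩
      exact ⟨_, h.mul_mem (h.mul_mem ha hx) hb⟩
  refine (hs.eq_bot_or_eq_top _ hI).resolve_left fun h0 => hx0 ?_
  refine hs.eq_zero_of_mul_left h fun a => hs.eq_zero_of_mul_right h fun b => ?_
  rw [← Submodule.mem_bot F, ← h0]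
  exact Submodule.subset_span ⟨a, b, rfl⟩

theorem IsGradedSimple.exists_homogeneous_ne_zero [Finite G] : ∃ g, ∃ x ∈ 𝒜 g, x ≠ 0 := by
  obtain ⟨a, b, hab⟩ := hs.sq_ne_zero
  obtain ⟨g, hg⟩ := h.exists_proj_ne_zero hab
  exact ⟨g, _, h.proj_mem g _, hg⟩

end Projections

/-! ### The degree-preserving centroid. -/

section Centroid

variable {F : Type*} {G : Type*} {A : Type*} [Field F] [Group G] [NonUnitalRing A] [Module F A]
  [IsScalarTower F A A] [SMulCommClass F A A] {𝒜 : G → Submodule F A}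

/-- The algebra of operators generated by the left and right multiplications and the projections
onto the homogeneous components. -/
def IsGrading.multAlg (h : IsGrading 𝒜) : Subalgebra F (Module.End F A) :=
  Algebra.adjoin F (Set.range (LinearMap.mulLeft F) ∪ Set.range (LinearMap.mulRight F) ∪
    Set.range h.proj)

variable (h : IsGrading 𝒜)

theorem IsGrading.mulLeft_mem (a : A) : LinearMap.mulLeft F a ∈ h.multAlg :=
  Algebra.subset_adjoin (Or.inl (Or.inl ⟨a, rfl⟩))

theorem IsGrading.mulRight_mem (a : A) : LinearMap.mulRight F a ∈ h.multAlg :=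
  Algebra.subset_adjoin (Or.inl (Or.inr ⟨a, rfl⟩))

theorem IsGrading.proj_mem_multAlg (g : G) : h.proj g ∈ h.multAlg :=
  Algebra.subset_adjoin (Or.inr ⟨g, rfl⟩)

/-- A subspace stable under the multiplications and the projections is a graded ideal. -/
theorem IsGradedSimple.isSimpleModule [Finite G] (hs : IsGradedSimple 𝒜) :
    IsSimpleModule h.multAlg A := by
  have : Nontrivial A := by
    obtain ⟨_, x, _, hx⟩ := hs.exists_homogeneous_ne_zero h
    exact ⟨x, 0, hx⟩
  rw [isSimpleModule_iff]
  refine ⟨fun N => ?_⟩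
  have hN : IsGradedIdeal 𝒜 (N.restrictScalars F) := by
    refine h.isGradedIdeal ?_ ?_ ?_
    · intro a x hx
      exact N.smul_mem (⟨_, h.mulLeft_mem a⟩ : h.multAlg) hx
    · intro a x hx
      exact N.smul_mem (⟨_, h.mulRight_mem a⟩ : h.multAlg) hx
    · intro g x hx
      exact N.smul_mem (⟨_, h.proj_mem_multAlg g⟩ : h.multAlg) hx
  rcases hs.eq_bot_or_eq_top _ hN with h0 | h0
  · left
    rwa [Submodule.restrictScalars_eq_bot_iff] at h0
  · right
    rwa [Submodule.restrictScalars_eq_top_iff] at h0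

/-- In a product `a * x`, one endomorphism can be moved to the left factor and the other to the
right one, in which case their order no longer matters. -/
theorem IsGradedSimple.commute_centroid [Finite G] (hs : IsGradedSimple 𝒜)
    (c d : Module.End h.multAlg A) : c * d = d * c := by
  have hl : ∀ (c : Module.End h.multAlg A) (a b : A), c (a * b) = a * c b := fun c a b =>
    map_smul c (⟨_, h.mulLeft_mem a⟩ : h.multAlg) b
  have hr : ∀ (c : Module.End h.multAlg A) (a b : A), c (a * b) = c a * b := fun c a b =>
    map_smul c (⟨_, h.mulRight_mem b⟩ : h.multAlg) a
  ext x
  rw [← sub_eq_zero]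
  refine hs.eq_zero_of_mul_left h fun a => ?_
  rw [mul_sub, sub_eq_zero]
  change a * c (d x) = a * d (c x)
  calc a * c (d x) = c a * d x := by rw [← hl, hr]
    _ = d (c (a * x)) := by rw [← hl, ← hr]
    _ = a * d (c x) := by rw [hl, hl]

open Classical in
/-- The degree-preserving centroid of a graded simple algebra is a field. -/
abbrev IsGradedSimple.centroidField [Finite G] (hs : IsGradedSimple 𝒜) :
    Field (Module.End h.multAlg A) :=
  letI := hs.isSimpleModule h
  { (inferInstance : DivisionRing (Module.End h.multAlg A)) with
    mul_comm := hs.commute_centroid h }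

end Centroid

/-! ### Density and finite dimension over the centroid. -/

section DenseCentroid

variable {F : Type u} {G : Type w} {A : Type v} [Field F] [Group G] [NonUnitalRing A] [Module F A]
  [IsScalarTower F A A] [SMulCommClass F A A] {𝒜 : G → Submodule F A}

/-- The field `C` acts on `A` by degree-preserving centralizers, and the multiplication algebra
of `A` is dense in the `C`-linear operators. -/
structure IsDenseCentroid (h : IsGrading 𝒜) (C : Type*) [Field C] [Module C A] : Prop where
  comm : ∀ m ∈ h.multAlg, ∀ (c : C) (x : A), m (c • x) = c • m x
  dense : ∀ (f : A →ₗ[C] A) (s : Finset A), ∃ m ∈ h.multAlg, ∀ x ∈ s, f x = m x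

theorem IsGradedSimple.exists_denseCentroid [Finite G] (h : IsGrading 𝒜)
    (hs : IsGradedSimple 𝒜) :
    ∃ (C : Type v) (_ : Field C) (_ : Algebra F C) (_ : Module C A) (_ : IsScalarTower F C A),
      IsDenseCentroid h C := by
  have := hs.isSimpleModule h
  let iF := hs.centroidField h
  let iA : @Algebra F (Module.End h.multAlg A) _ iF.toDivisionRing.toRing.toSemiring :=
    Module.End.instAlgebra F h.multAlg A
  let iM : @Module (Module.End h.multAlg A) A iF.toDivisionRing.toRing.toSemiring _ :=
    Module.End.applyModule
  refine ⟨Module.End h.multAlg A, iF, iA, iM, ?_, ?_, ?_⟩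
  · exact ⟨fun r c x => rfl⟩
  · intro m hm c x
    exact (map_smul c (⟨m, hm⟩ : h.multAlg) x).symm
  · intro f s
    obtain ⟨r, hr⟩ := jacobson_density (R := h.multAlg) (M := A) f s
    exact ⟨r.1, r.2, hr⟩

namespace IsDenseCentroid

variable {h : IsGrading 𝒜} {C : Type*} [Field C] [Module C A] (hC : IsDenseCentroid h C)
include hC

theorem isScalarTower : IsScalarTower C A A :=
  ⟨fun c a b => hC.comm _ (h.mulRight_mem b) c a |>.symm ▸ rfl⟩

theorem smulCommClass : SMulCommClass C A A :=
  ⟨fun c a b => (hC.comm _ (h.mulLeft_mem a) c b).symm⟩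

theorem proj_smul (g : G) (c : C) (a : A) : h.proj g (c • a) = c • h.proj g a :=
  hC.comm _ (h.proj_mem_multAlg g) c a

theorem smul_mem (g : G) (c : C) {a : A} (ha : a ∈ 𝒜 g) : c • a ∈ 𝒜 g := by
  rw [← h.proj_of_mem ha, ← hC.proj_smul]
  exact h.proj_mem g _

/-- The homogeneous components, as subspaces over the centroid. -/
def component (g : G) : Submodule C A :=
  { (𝒜 g).toAddSubmonoid with smul_mem' := fun c _ ha => hC.smul_mem g c ha }

end IsDenseCentroid

/-- The algebra of operators generated by the left and right multiplications. -/
def lrAlg (F A : Type*) [Field F] [NonUnitalRing A] [Module F A]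
    [IsScalarTower F A A] [SMulCommClass F A A] : Subalgebra F (Module.End F A) :=
  Algebra.adjoin F (Set.range (LinearMap.mulLeft F) ∪ Set.range (LinearMap.mulRight F))

/-- The span of the operators `x ↦ a * x * b`. -/
def twoSidedSpan (F A : Type*) [Field F] [NonUnitalRing A] [Module F A]
    [IsScalarTower F A A] [SMulCommClass F A A] : Submodule F (Module.End F A) :=
  Submodule.span F {t | ∃ a b : A, t = LinearMap.mulLeft F a * LinearMap.mulRight F b}

/-- On a single component projections can be absorbed into multiplications: for `v` of degree `g`,
the part of `a * v` in degree `k` is the product with `v` of the component of `a` in degree `k *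
g⁻¹`. A composite is handled by summing over the intermediate degree. This is needed because the
available identity concerns multiplications only. -/
theorem exists_lrAlg_eq_proj [Finite G] (h : IsGrading 𝒜) {m : Module.End F A}
    (hm : m ∈ h.multAlg) (g k : G) :
    ∃ m' ∈ lrAlg F A, ∀ v ∈ 𝒜 g, m' v = h.proj k (m v) := by
  classical
  cases nonempty_fintype G
  induction hm using Algebra.adjoin_induction generalizing g k with
  | mem m hm =>
    rcases hm with (⟨a, rfl⟩ | ⟨a, rfl⟩) | ⟨l, rfl⟩
    · refine ⟨LinearMap.mulLeft F (h.proj (k * g⁻¹) a),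
        Algebra.subset_adjoin (Or.inl ⟨_, rfl⟩), fun v hv => ?_⟩
      simp [h.proj_mul_right hv]
    · refine ⟨LinearMap.mulRight F (h.proj (g⁻¹ * k) a),
        Algebra.subset_adjoin (Or.inr ⟨_, rfl⟩), fun v hv => ?_⟩
      simp [h.proj_mul_left hv]
    · refine ⟨if g = l ∧ g = k then 1 else 0, ?_, fun v hv => ?_⟩
      · split_ifs
        · exact Subalgebra.one_mem _
        · exact Subalgebra.zero_mem _
      · rw [h.proj_eq_ite hv]
        by_cases h1 : g = l
        · by_cases h2 : g = k
          · simp [h1, ← h2, h.proj_of_mem (h1 ▸ hv)]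
          · rw [if_pos h1, h.proj_of_ne hv h2, if_neg (fun h => h2 h.2)]
            rfl
        · simp [h1]
  | algebraMap r =>
    by_cases h2 : g = k
    · subst h2
      refine ⟨algebraMap F _ r, Subalgebra.algebraMap_mem _ r, fun v hv => ?_⟩
      rw [Module.algebraMap_end_apply, map_smul, h.proj_of_mem hv]
    · refine ⟨0, Subalgebra.zero_mem _, fun v hv => ?_⟩
      rw [Module.algebraMap_end_apply, map_smul, h.proj_of_ne hv h2, smul_zero]
      rfl
  | add m n _ _ hm hn =>
    obtain ⟨m', hm', h1⟩ := hm g k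
    obtain ⟨n', hn', h2⟩ := hn g k
    refine ⟨m' + n', Subalgebra.add_mem _ hm' hn', fun v hv => ?_⟩
    rw [LinearMap.add_apply, LinearMap.add_apply, map_add, h1 v hv, h2 v hv]
  | mul m n _ _ hm hn =>
    choose m' hm' h1 using fun l => hm l k
    choose n' hn' h2 using fun l => hn g l
    refine ⟨∑ l, m' l * n' l, Subalgebra.sum_mem _ fun l _ =>
      Subalgebra.mul_mem _ (hm' l) (hn' l), fun v hv => ?_⟩
    rw [LinearMap.sum_apply, Module.End.mul_apply]
    conv_rhs => rw [← h.sum_proj (n v), map_sum, map_sum]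
    refine Finset.sum_congr rfl fun l _ => ?_
    rw [Module.End.mul_apply, h2 l v hv, h1 l _ (h.proj_mem l _)]

theorem exists_lrAlg_eq [Finite G] (h : IsGrading 𝒜) {m : Module.End F A}
    (hm : m ∈ h.multAlg) (g : G) :
    ∃ m' ∈ lrAlg F A, ∀ v ∈ 𝒜 g, m' v = m v := by
  cases nonempty_fintype G
  choose m' hm' h1 using exists_lrAlg_eq_proj h hm g
  refine ⟨∑ k, m' k, Subalgebra.sum_mem _ fun k _ => hm' k, fun v hv => ?_⟩
  rw [LinearMap.sum_apply]
  simp_rw [h1 _ v hv, h.sum_proj]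

theorem mul_mem_twoSidedSpan {m : Module.End F A} (hm : m ∈ lrAlg F A) {t : Module.End F A}
    (ht : t ∈ twoSidedSpan F A) : t * m ∈ twoSidedSpan F A := by
  induction hm using Algebra.adjoin_induction generalizing t with
  | mem m hm =>
    induction ht using Submodule.span_induction with
    | mem t ht =>
      obtain ⟨a, b, rfl⟩ := ht
      rcases hm with ⟨c, rfl⟩ | ⟨c, rfl⟩
      · refine Submodule.subset_span ⟨a * c, b, ?_⟩
        ext x; simp [mul_assoc]
      · refine Submodule.subset_span ⟨a, c * b, ?_⟩
        ext x; simp [mul_assoc]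
    | zero => rw [zero_mul]; exact Submodule.zero_mem _
    | add s t _ _ hs ht => rw [add_mul]; exact Submodule.add_mem _ hs ht
    | smul c t _ ht => rw [smul_mul_assoc]; exact Submodule.smul_mem _ c ht
  | algebraMap r =>
    rw [← Algebra.commutes, ← Algebra.smul_def]
    exact Submodule.smul_mem _ r ht
  | add m n _ _ hm hn => rw [mul_add]; exact Submodule.add_mem _ (hm ht) (hn ht)
  | mul m n _ _ hm hn => rw [← mul_assoc]; exact hn (hm ht)

/-- The last operator acts first, so right factors accumulate in reverse order. Hence the pairing of
`σ` with its reversal in the bimodule identity. -/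
theorem inr_prod_map_apply {X : Type*} (l : List X) (a b : X → A) (x : A) :
    (Unitization.inr ((l.map fun i => LinearMap.mulLeft F (a i) * LinearMap.mulRight F (b i)).prod x) :
      Unitization F A) = wordMap F A l a * Unitization.inr x * wordMap F A l.reverse b := by
  induction l with
  | nil => simp [wordMap]
  | cons i l ih =>
    rw [List.map_cons, List.prod_cons, List.reverse_cons, wordMap_append]
    simp only [Module.End.mul_apply, LinearMap.mulLeft_apply, LinearMap.mulRight_apply]
    rw [Unitization.inr_mul, Unitization.inr_mul, ih]
    simp [wordMap, mul_assoc]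

/-- By multilinearity it suffices to substitute single operators `x ↦ a * x * b`, where the
expression is the bimodule identity. -/
theorem twoSidedSpan_identity {n : ℕ} {c : Equiv.Perm (Fin n) → F}
    (hc : ∀ (a b : Fin n → A) (x : Unitization F A),
        ∑ σ : Equiv.Perm (Fin n), c σ • (wordMap F A (List.ofFn σ) a * x *
          wordMap F A (List.ofFn (Fin.revPerm.trans σ)) b) = 0)
    (t : Fin n → Module.End F A) (ht : ∀ i, t i ∈ twoSidedSpan F A) :
    ∑ σ : Equiv.Perm (Fin n), c σ • (List.ofFn fun k => t (σ k)).prod = 0 := by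
  let Φ : MultilinearMap F (fun _ : Fin n => Module.End F A) (Module.End F A) :=
    ∑ σ : Equiv.Perm (Fin n),
      c σ • (MultilinearMap.mkPiAlgebraFin F n (Module.End F A)).domDomCongr σ
  have hΦ : ∀ t, Φ t = ∑ σ : Equiv.Perm (Fin n), c σ • (List.ofFn fun k => t (σ k)).prod := by
    intro t
    simp [Φ]
  rw [← hΦ]
  choose N r p hp using fun i => Submodule.mem_span_set'.1 (ht i)
  obtain rfl : (fun i => ∑ j, r i j • (p i j : Module.End F A)) = t := funext hp
  rw [MultilinearMap.map_sum]
  refine Finset.sum_eq_zero fun e _ => ?_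
  rw [MultilinearMap.map_smul_univ, hΦ]
  choose a b hab using fun i => (p i (e i)).2
  simp_rw [hab]
  convert smul_zero _
  ext x
  apply Unitization.inr_injective (R := F)
  rw [LinearMap.zero_apply, Unitization.inr_zero, ← hc a b (Unitization.inr x), LinearMap.sum_apply]
  change Unitization.inrNonUnitalAlgHom F A _ = _
  rw [map_sum]
  refine Finset.sum_congr rfl fun σ _ => ?_
  change (Unitization.inr _ : Unitization F A) = _
  rw [LinearMap.smul_apply, Unitization.inr_smul]
  congr 1
  have h1 : (List.ofFn fun k => LinearMap.mulLeft F (a (σ k)) * LinearMap.mulRight F (b (σ k))) =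
      (List.ofFn σ).map fun i => LinearMap.mulLeft F (a i) * LinearMap.mulRight F (b i) := by
    rw [List.map_ofFn]; rfl
  have h2 : List.ofFn (Fin.revPerm.trans σ) = (List.ofFn σ).reverse := by
    apply List.ext_getElem
    · simp
    · intro i h1 h2
      simp only [List.getElem_ofFn, List.getElem_reverse, List.length_ofFn, Equiv.trans_apply,
        Fin.revPerm_apply, Fin.rev]
      congr 2
      omega
  rw [h1, inr_prod_map_apply, h2]

theorem prod_shift_apply {R M : Type*} [Semiring R] [AddCommMonoid M] [Module R M] {n : ℕ}
    {E : Fin n → Module.End R M} {w : ℕ → M}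
    (hE : ∀ k i, E k (w i) = if i = k + 1 then w k else 0) (l : List (Fin n)) (i : ℕ)
    (hl : l.map Fin.val = List.range' i l.length) : (l.map E).prod (w (i + l.length)) = w i := by
  induction l generalizing i with
  | nil => simp
  | cons k l ih =>
    simp only [List.map_cons, List.length_cons, List.range'_succ, List.cons.injEq] at hl
    have := ih (i + 1) hl.2
    rw [add_right_comm, add_assoc] at this
    rw [List.map_cons, List.prod_cons, Module.End.mul_apply, List.length_cons, this, hE, hl.1,
      if_pos rfl]

/-- `E k` moves only the vector with index `k + 1`, so a product not killing `w j` must go down from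
`j` one step at a time, which fixes the order of its factors. -/
theorem eq_range_of_prod_shift_apply_ne_zero {R M : Type*} [Semiring R] [AddCommMonoid M]
    [Module R M] {n : ℕ} {E : Fin n → Module.End R M} {w : ℕ → M}
    (hE : ∀ k i, E k (w i) = if i = k + 1 then w k else 0) (l : List (Fin n)) (j : ℕ)
    (hl : (l.map E).prod (w j) ≠ 0) :
    ∃ i, i + l.length = j ∧ l.map Fin.val = List.range' i l.length := by
  induction l with
  | nil => exact ⟨j, rfl, rfl⟩
  | cons k l ih =>
    rw [List.map_cons, List.prod_cons, Module.End.mul_apply] at hl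
    obtain ⟨i, rfl, hi⟩ := ih fun h => hl (by rw [h, map_zero])
    rw [prod_shift_apply hE l i hi, hE] at hl
    obtain rfl : i = k + 1 := by
      by_contra h
      exact hl (if_neg h)
    exact ⟨k, by simp only [List.length_cons]; omega, by simp [List.range'_succ, hi]⟩

theorem ofFn_perm_eq_range {n : ℕ} {ρ : Equiv.Perm (Fin n)}
    (h : (List.ofFn ρ).map Fin.val = List.range' 0 n) : ρ = 1 := by
  ext i
  have h1 : ((List.ofFn ρ).map Fin.val)[i.1]'(by simp) = (List.range' 0 n)[i.1]'(by simp) := by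
    simp only [h]
  simpa using h1

/-- The dimension bound: a multilinear identity of the two-sided multiplications of degree `n`
bounds the dimension of the homogeneous components over the centroid by `n`. -/
theorem IsDenseCentroid.not_linearIndependent [Finite G] {h : IsGrading 𝒜} (hs : IsGradedSimple 𝒜)
    {C : Type*} [Field C] [Module C A] (hC : IsDenseCentroid h C) {n : ℕ}
    {c : Equiv.Perm (Fin n) → F} (hc0 : c ≠ 0)
    (hc : ∀ t : Fin n → Module.End F A, (∀ i, t i ∈ twoSidedSpan F A) →
      ∑ σ : Equiv.Perm (Fin n), c σ • (List.ofFn fun k => t (σ k)).prod = 0)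
    {g : G} (v : Fin (n + 1) → A) (hv : ∀ i, v i ∈ 𝒜 g) : ¬ LinearIndependent C v := by
  classical
  intro hli
  -- The value zero beyond `n` is harmless, since the shifts `E k` have `k + 1 ≤ n`.
  let w : ℕ → A := fun i => if hi : i < n + 1 then v ⟨i, hi⟩ else 0
  have hw : ∀ i : Fin (n + 1), w i = v i := fun i => dif_pos i.2
  have hex : ∀ (k : Fin (n + 1)) (y : A), ∃ t ∈ twoSidedSpan F A, ∀ i : Fin (n + 1),
      t (v i) = if i = k then y else 0 := by
    intro k y
    have hdelta : ∀ s : A, ∃ m ∈ lrAlg F A, ∀ i : Fin (n + 1), m (v i) = if i = k then s else 0 := by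
      intro s
      obtain ⟨f, hf⟩ : ∃ f : A →ₗ[C] A, ∀ i, f (v i) = if i = k then s else 0 := by
        obtain ⟨f, hf⟩ := (LinearMap.exists_extend
          ((Module.Basis.span hli).constr C fun i => if i = k then s else 0))
        refine ⟨f, fun i => ?_⟩
        have := LinearMap.congr_fun hf (Module.Basis.span hli i)
        rw [Module.Basis.constr_basis] at this
        rw [← this, LinearMap.comp_apply, Submodule.subtype_apply, Module.Basis.span_apply]
      obtain ⟨m, hm, hfm⟩ := hC.dense f (Finset.univ.image v)
      obtain ⟨m', hm', h1⟩ := exists_lrAlg_eq h hm g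
      refine ⟨m', hm', fun i => ?_⟩
      rw [h1 _ (hv i), ← hfm _ (Finset.mem_image_of_mem v (Finset.mem_univ i)), hf]
    obtain ⟨_, x, hx, hx0⟩ := hs.exists_homogeneous_ne_zero h
    -- Density yields operators in `lrAlg`, not in `twoSidedSpan`. Writing the target as a sum of `a
    -- * x * b` puts a two-sided multiplication in front, and `twoSidedSpan` absorbs `lrAlg` on the
    -- right.
    have hy : y ∈ Submodule.span F {y | ∃ a b : A, y = a * x * b} := by
      rw [hs.span_mul_mul h hx hx0]
      exact Submodule.mem_top
    induction hy using Submodule.span_induction with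
    | mem y hy =>
      obtain ⟨a, b, rfl⟩ := hy
      obtain ⟨m, hm, h1⟩ := hdelta x
      refine ⟨LinearMap.mulLeft F a * LinearMap.mulRight F b * m,
        mul_mem_twoSidedSpan hm (Submodule.subset_span ⟨a, b, rfl⟩), fun i => ?_⟩
      rw [Module.End.mul_apply, h1]
      split_ifs
      · simp [mul_assoc]
      · rw [map_zero]
    | zero => exact ⟨0, Submodule.zero_mem _, fun i => by simp⟩
    | add y z _ _ hy hz =>
      obtain ⟨s, hs, h1⟩ := hy
      obtain ⟨t, ht, h2⟩ := hz
      refine ⟨s + t, Submodule.add_mem _ hs ht, fun i => ?_⟩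
      rw [LinearMap.add_apply, h1, h2]
      split_ifs <;> simp
    | smul r y _ hy =>
      obtain ⟨s, hs, h1⟩ := hy
      refine ⟨r • s, Submodule.smul_mem _ r hs, fun i => ?_⟩
      rw [LinearMap.smul_apply, h1]
      split_ifs <;> simp
  choose E hET hEv using fun k : Fin n => hex k.succ (v k.castSucc)
  have hE : ∀ k i, E k (w i) = if i = k + 1 then w k else 0 := by
    intro k i
    by_cases hi : i < n + 1
    · have h1 := hEv k ⟨i, hi⟩
      have h2 : w k = v k.castSucc := hw k.castSucc
      rw [h2, show w i = v ⟨i, hi⟩ from hw ⟨i, hi⟩, h1]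
      simp [Fin.ext_iff]
    · rw [show w i = 0 from dif_neg hi, map_zero, if_neg]
      omega
  obtain ⟨σ₀, hσ₀⟩ := Function.ne_iff.1 hc0
  -- Relabelling by `σ₀` places the shifts in descending order exactly in the term of `σ₀`, whose
  -- coefficient is nonzero. Evaluated at the top vector, this term is a nonzero multiple of `v 0`,
  -- and all others vanish.
  have key := LinearMap.congr_fun (hc (fun i => E (σ₀.symm i)) fun i => hET _) (w n)
  rw [LinearMap.sum_apply, Finset.sum_eq_single σ₀] at key
  · have h1 : (List.ofFn fun k => E (σ₀.symm (σ₀ k))) = (List.finRange n).map E := by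
      rw [List.ofFn_eq_map]
      simp
    have h2 := prod_shift_apply hE (List.finRange n) 0 (by simp [List.range_eq_range'])
    rw [List.length_finRange, zero_add] at h2
    rw [LinearMap.smul_apply, h1, h2, LinearMap.zero_apply] at key
    exact (smul_ne_zero hσ₀ (hw 0 ▸ hli.ne_zero 0)) key
  · intro σ _ hσ
    rw [LinearMap.smul_apply]
    convert smul_zero _
    by_contra hne
    have h1 : (List.ofFn fun k => E (σ₀.symm (σ k))) = (List.ofFn (σ.trans σ₀.symm)).map E := by
      rw [List.map_ofFn]; rfl
    rw [h1] at hne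
    obtain ⟨i, hi, h2⟩ := eq_range_of_prod_shift_apply_ne_zero hE _ _ hne
    rw [List.length_ofFn] at hi h2
    obtain rfl : i = 0 := by omega
    have h3 := ofFn_perm_eq_range h2
    apply hσ
    ext k
    have := congrArg σ₀ (Equiv.congr_fun h3 k)
    simpa using congrArg Fin.val this
  · intro h
    exact absurd (Finset.mem_univ _) h

theorem IsDenseCentroid.finiteDimensional [Finite G] {h : IsGrading 𝒜} (hs : IsGradedSimple 𝒜)
    {C : Type*} [Field C] [Module C A] (hC : IsDenseCentroid h C) (hPI : IsPI F A) :
    FiniteDimensional C A := by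
  obtain ⟨n, c, hc0, hc⟩ := hPI.exists_bimodule_identity
  have hfin : ∀ g, FiniteDimensional C (hC.component g) := by
    intro g
    by_contra hnot
    have hr : ((n + 1 : ℕ) : Cardinal) ≤ Module.rank C (hC.component g) := by
      by_contra! hlt
      exact hnot (Module.rank_lt_aleph0_iff.1 (hlt.trans (Cardinal.natCast_lt_aleph0)))
    obtain ⟨v, hv⟩ := exists_linearIndependent_of_le_rank hr
    exact hC.not_linearIndependent hs hc0 (fun t ht => twoSidedSpan_identity hc t ht)
      (fun i => (v i : A)) (fun i => (v i).2) (hv.map' _ (Submodule.ker_subtype _))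
  cases nonempty_fintype G
  have htop : (⨆ g, hC.component g) = ⊤ := by
    rw [eq_top_iff]
    intro a _
    rw [← h.sum_proj a]
    exact Submodule.sum_mem _ fun g _ => Submodule.mem_iSup_of_mem g (h.proj_mem g a)
  have : FiniteDimensional C (⨆ g, hC.component g : Submodule C A) :=
    Submodule.finiteDimensional_iSup _
  rw [htop] at this
  exact Module.Finite.equiv Submodule.topEquiv

end DenseCentroid

/-! ### A graded division idempotent from a minimal graded left ideal. -/

section PrimitiveIdempotent

variable {K : Type*} {G : Type*} {B : Type*} [Field K] [Group G] [NonUnitalRing B] [Module K B]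
  {ℬ : G → Submodule K B}

/-- `e` is an idempotent of degree `1` such that `e * B * e` is a graded division algebra. -/
structure IsGradedDivisionIdempotent (ℬ : G → Submodule K B) (e : B) : Prop where
  mem : e ∈ ℬ 1
  mul_self : e * e = e
  ne_zero : e ≠ 0
  exists_inv : ∀ (h : G) (d : B), d ∈ ℬ h → e * d = d → d * e = d → d ≠ 0 →
    ∃ d' ∈ ℬ h⁻¹, e * d' = d' ∧ d' * e = d' ∧ d' * d = e

theorem IsGradedSimple.exists_minimal_left_ideal [Finite G] [FiniteDimensional K B]
    (hB : IsGrading ℬ) (hs : IsGradedSimple ℬ) :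
    ∃ L : Submodule K B, L ≠ ⊥ ∧ (∀ a, ∀ x ∈ L, a * x ∈ L) ∧ (∀ g, ∀ x ∈ L, hB.proj g x ∈ L) ∧
      ∀ N : Submodule K B, N ≤ L → N ≠ ⊥ → (∀ a, ∀ x ∈ N, a * x ∈ N) →
        (∀ g, ∀ x ∈ N, hB.proj g x ∈ N) → N = L := by
  let S : Set (Submodule K B) :=
    {L | L ≠ ⊥ ∧ (∀ a, ∀ x ∈ L, a * x ∈ L) ∧ (∀ g, ∀ x ∈ L, hB.proj g x ∈ L)}
  have hS : S.Nonempty := by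
    obtain ⟨_, x, _, hx⟩ := hs.exists_homogeneous_ne_zero hB
    refine ⟨⊤, fun h => hx ?_, fun _ _ _ => Submodule.mem_top, fun _ _ _ => Submodule.mem_top⟩
    rw [← Submodule.mem_bot K, ← h]
    exact Submodule.mem_top
  obtain ⟨L, hL, hmin⟩ := (wellFounded_lt (α := Submodule K B)).has_min S hS
  refine ⟨L, hL.1, hL.2.1, hL.2.2, fun N hN h0 hl hp => ?_⟩
  by_contra hne
  exact hmin N ⟨h0, hl, hp⟩ (lt_of_le_of_ne hN hne)

variable [IsScalarTower K B B] [SMulCommClass K B B]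

/-- An element annihilated by `a * x * b` for all `a`, `b` is zero. -/
theorem IsGradedSimple.eq_zero_of_mul_mul_mul [Finite G] (hB : IsGrading ℬ)
    (hs : IsGradedSimple ℬ) {g : G} {x y : B} (hx : x ∈ ℬ g) (hx0 : x ≠ 0)
    (h : ∀ a b, a * x * b * y = 0) : y = 0 := by
  refine hs.eq_zero_of_mul_left hB fun c => ?_
  have hc : c ∈ Submodule.span K {y | ∃ a b : B, y = a * x * b} := by
    rw [hs.span_mul_mul hB hx hx0]
    exact Submodule.mem_top
  induction hc using Submodule.span_induction with
  | mem c hc => obtain ⟨a, b, rfl⟩ := hc; exact h a b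
  | zero => rw [zero_mul]
  | add c d _ _ hc hd => rw [add_mul, hc, hd, add_zero]
  | smul r c _ hc => rw [smul_mul_assoc, hc, smul_zero]

/-- This is Brauer's lemma in graded form. For homogeneous `x ∈ L` with `L x ≠ 0`, minimality makes
right multiplication by `x` bijective on `L`; a solution of `b * x = x` has a degree-one component
`e`, and injectivity gives `e² = e`. -/
theorem IsGradedSimple.exists_divisionIdempotent [Finite G] [FiniteDimensional K B]
    (hB : IsGrading ℬ) (hs : IsGradedSimple ℬ) : ∃ e, IsGradedDivisionIdempotent ℬ e := by
  obtain ⟨L, hL0, hLl, hLp, hmin⟩ := hs.exists_minimal_left_ideal hB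
  obtain ⟨z, hzL, hz0⟩ := (Submodule.ne_bot_iff L).1 hL0
  obtain ⟨k, hk⟩ := hB.exists_proj_ne_zero hz0
  -- Otherwise `L² = 0`, and then a nonzero homogeneous element of `L` would annihilate a two-sided
  -- ideal that is all of the algebra.
  obtain ⟨g, x, hxg, hxL, y, hyL, hyx⟩ : ∃ g, ∃ x ∈ ℬ g, x ∈ L ∧ ∃ y ∈ L, y * x ≠ 0 := by
    by_contra! hc
    refine hk (hs.eq_zero_of_mul_mul_mul hB (hB.proj_mem k z) hk fun a b => ?_)
    cases nonempty_fintype G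
    rw [mul_assoc, mul_assoc, ← hB.sum_proj (b * hB.proj k z), Finset.mul_sum]
    rw [Finset.sum_eq_zero, mul_zero]
    intro l _
    exact hc l _ (hB.proj_mem l _) (hLp _ _ (hLl _ _ (hLp _ _ hzL))) _ (hLp _ _ hzL)
  have hx0 : x ≠ 0 := by rintro rfl; exact hyx (mul_zero y)
  have hLx : L.map (LinearMap.mulRight K x) = L := by
    refine hmin _ ?_ ?_ ?_ ?_
    · rintro _ ⟨b, _, rfl⟩
      exact hLl b x hxL
    · intro h
      apply hyx
      rw [← Submodule.mem_bot K, ← h]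
      exact ⟨y, hyL, rfl⟩
    · rintro a _ ⟨b, hb, rfl⟩
      exact ⟨a * b, hLl a b hb, mul_assoc a b x⟩
    · rintro l _ ⟨b, hb, rfl⟩
      exact ⟨_, hLp _ b hb, (hB.proj_mul_right hxg l b).symm⟩
  obtain ⟨b, hbL, hbx⟩ : x ∈ L.map (LinearMap.mulRight K x) := hLx.symm ▸ hxL
  set e := hB.proj 1 b with he
  have heL : e ∈ L := hLp 1 b hbL
  have hex : e * x = x := by
    have := hB.proj_mul_right hxg g b
    rw [mul_inv_cancel, ← he] at this
    rw [← this, show b * x = x from hbx, hB.proj_of_mem hxg]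
  have hann : ∀ z ∈ L, z * x = 0 → z = 0 := by
    have hbot : L ⊓ LinearMap.ker (LinearMap.mulRight K x) = ⊥ := by
      by_contra hne
      have := hmin _ inf_le_left hne
        (fun a z hz => ⟨hLl a z hz.1, by
          have : z * x = 0 := hz.2
          simp [mul_assoc, this]⟩)
        (fun l z hz => ⟨hLp l z hz.1, by
          have h1 : z * x = 0 := hz.2
          have := hB.proj_mul_right hxg (l * g) z
          rw [h1, map_zero, mul_inv_cancel_right] at this
          exact this.symm⟩)
      rw [inf_eq_left] at this
      exact hyx (this hyL)
    intro z hz hzx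
    rw [← Submodule.mem_bot K, ← hbot]
    exact ⟨hz, hzx⟩
  have hee : e * e = e := by
    rw [← sub_eq_zero]
    refine hann _ (Submodule.sub_mem _ (hLl _ _ heL) heL) ?_
    rw [sub_mul, mul_assoc, hex, hex, sub_self]
  refine ⟨e, hB.proj_mem 1 b, hee, ?_, ?_⟩
  · intro h0
    rw [h0, zero_mul] at hex
    exact hx0 hex.symm
  · intro h d hd hed hde hd0
    have hdL : d ∈ L := hde ▸ hLl d e heL
    -- Minimality again: `B d` is a nonzero graded left ideal inside `L`, so it contains `e`. The
    -- component of degree `h⁻¹` of the resulting left inverse already suffices.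
    have hBd : LinearMap.range (LinearMap.mulRight K d) = L := by
      refine hmin _ ?_ ?_ ?_ ?_
      · rintro _ ⟨b, rfl⟩
        exact hLl b d hdL
      · intro h
        refine hd0 (hs.eq_zero_of_mul_left hB fun a => ?_)
        rw [← Submodule.mem_bot K, ← h]
        exact ⟨a, rfl⟩
      · rintro a _ ⟨b, rfl⟩
        exact ⟨a * b, mul_assoc a b d⟩
      · rintro l _ ⟨b, rfl⟩
        exact ⟨_, (hB.proj_mul_right hd l b).symm⟩
    obtain ⟨c, hc⟩ : e ∈ LinearMap.range (LinearMap.mulRight K d) := hBd.symm ▸ heL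
    have hc : c * d = e := hc
    have hcd : hB.proj h⁻¹ c * d = e := by
      have := hB.proj_mul_right hd 1 c
      rw [one_mul, hc, hB.proj_of_mem (hB.proj_mem 1 b)] at this
      exact this.symm
    refine ⟨e * hB.proj h⁻¹ c * e, ?_, ?_, ?_, ?_⟩
    · have := hB.mul_mem (hB.mul_mem (hB.proj_mem 1 b) (hB.proj_mem h⁻¹ c)) (hB.proj_mem 1 b)
      rwa [one_mul, mul_one] at this
    · rw [← mul_assoc, ← mul_assoc, hee]
    · rw [mul_assoc, hee]
    · rw [mul_assoc, hed, mul_assoc, hcd, hee]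

end PrimitiveIdempotent

/-! ### The twisted group algebra `e B e` and dual systems. -/

section GradedDivision

variable {K : Type*} {G : Type*} {B : Type*} [Field K] [Group G] [NonUnitalRing B] [Module K B]
  [IsScalarTower K B B] [SMulCommClass K B B] {ℬ : G → Submodule K B} {e : B}

namespace IsGradedDivisionIdempotent

variable (he : IsGradedDivisionIdempotent ℬ e)
include he

omit [IsScalarTower K B B] [SMulCommClass K B B] in
theorem exists_two_sided_inv {h : G} {d : B} (hd : d ∈ ℬ h) (hed : e * d = d) (hde : d * e = d)
    (hd0 : d ≠ 0) :
    ∃ d' ∈ ℬ h⁻¹, e * d' = d' ∧ d' * e = d' ∧ d' * d = e ∧ d * d' = e := by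
  obtain ⟨d', hd', h1, h2, h3⟩ := he.exists_inv h d hd hed hde hd0
  have hd'0 : d' ≠ 0 := by
    rintro rfl
    exact he.ne_zero (by rw [← h3, zero_mul])
  obtain ⟨d'', -, -, h5, h6⟩ := he.exists_inv _ d' hd' h1 h2 hd'0
  have : d'' = d := by rw [← h5, ← h3, ← mul_assoc, h6, hed]
  exact ⟨d', hd', h1, h2, h3, this ▸ h6⟩

omit [IsScalarTower K B B] [SMulCommClass K B B] in
theorem mul_ne_zero {h : G} {d d' : B} (hd : d ∈ ℬ h) (hed : e * d = d) (hde : d * e = d)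
    (hd0 : d ≠ 0) (hed' : e * d' = d') (hd'0 : d' ≠ 0) : d * d' ≠ 0 := by
  intro h0
  obtain ⟨c, -, -, -, h3⟩ := he.exists_inv h d hd hed hde hd0
  apply hd'0
  rw [← hed', ← h3, mul_assoc, h0, mul_zero]

/-- The component of degree `1` of `e * B * e` consists of scalars. -/
theorem exists_smul_eq [IsAlgClosed K] [FiniteDimensional K B] (hB : IsGrading ℬ) {d : B}
    (hd : d ∈ ℬ 1) (hed : e * d = d) (hde : d * e = d) : ∃ μ : K, d = μ • e := by
  let D : Submodule K B :=
    { carrier := {x | x ∈ ℬ 1 ∧ e * x = x ∧ x * e = x}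
      add_mem' := fun hx hy => ⟨Submodule.add_mem _ hx.1 hy.1, by rw [mul_add, hx.2.1, hy.2.1],
        by rw [add_mul, hx.2.2, hy.2.2]⟩
      zero_mem' := ⟨Submodule.zero_mem _, mul_zero _, zero_mul _⟩
      smul_mem' := fun c x hx => ⟨Submodule.smul_mem _ c hx.1, by rw [mul_smul_comm, hx.2.1],
        by rw [smul_mul_assoc, hx.2.2]⟩ }
  have heD : e ∈ D := ⟨he.mem, he.mul_self, he.mul_self⟩
  have : Nontrivial D := ⟨⟨e, heD⟩, 0, fun h => he.ne_zero (congrArg Subtype.val h)⟩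
  let T : Module.End K D := (LinearMap.mulLeft K d).restrict fun x hx => by
    refine ⟨?_, ?_, ?_⟩
    · have := hB.mul_mem hd hx.1
      rwa [one_mul] at this
    · rw [LinearMap.mulLeft_apply, ← mul_assoc, hed]
    · rw [LinearMap.mulLeft_apply, mul_assoc, hx.2.2]
  -- An eigenvector of left multiplication by `d` is invertible in `e B e`, and cancelling it gives
  -- `d = μ • e`.
  obtain ⟨μ, hμ⟩ := Module.End.exists_eigenvalue T
  obtain ⟨x, hx⟩ := hμ.exists_hasEigenvector
  have h1 : d * x.1 = μ • x.1 := congrArg Subtype.val hx.apply_eq_smul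
  have hx0 : x.1 ≠ 0 := fun h => hx.2 (Subtype.ext h)
  obtain ⟨y, -, -, -, -, hy⟩ := he.exists_two_sided_inv x.2.1 x.2.2.1 x.2.2.2 hx0
  exact ⟨μ, by rw [← hde, ← hy, ← mul_assoc, h1, smul_mul_assoc]⟩

/-- The support of `e * B * e`. -/
def support (hB : IsGrading ℬ) : Subgroup G where
  carrier := {h | ∃ d ∈ ℬ h, e * d = d ∧ d * e = d ∧ d ≠ 0}
  one_mem' := ⟨e, he.mem, he.mul_self, he.mul_self, he.ne_zero⟩
  mul_mem' := by
    rintro a b ⟨x, hx, h1, h2, h3⟩ ⟨y, hy, h4, h5, h6⟩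
    exact ⟨x * y, hB.mul_mem hx hy, by rw [← mul_assoc, h1], by rw [mul_assoc, h5],
      he.mul_ne_zero hx h1 h2 h3 h4 h6⟩
  inv_mem' := by
    rintro a ⟨x, hx, h1, h2, h3⟩
    obtain ⟨y, hy, h4, h5, h6⟩ := he.exists_inv a x hx h1 h2 h3
    refine ⟨y, hy, h4, h5, ?_⟩
    rintro rfl
    exact he.ne_zero (by rw [← h6, zero_mul])

/-- `e * B * e` is a twisted group algebra. -/
theorem exists_twisted_basis [IsAlgClosed K] [FiniteDimensional K B] (hB : IsGrading ℬ) :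
    ∃ (H : Subgroup G) (α : TwoCocycle H K) (u : H → B),
      (∀ h : H, u h ∈ ℬ h) ∧ (∀ h, e * u h = u h) ∧ (∀ h, u h * e = u h) ∧ (∀ h, u h ≠ 0) ∧
      (∀ a b, u a * u b = (α.toFun a b : K) • u (a * b)) ∧
      ∀ g, ∀ d ∈ ℬ g, e * d = d → d * e = d → d ≠ 0 →
        ∃ (h : H) (μ : K), (h : G) = g ∧ d = μ • u h := by
  choose u hu h1 h2 h3 using fun h : he.support hB => h.2
  have hspan : ∀ h : he.support hB, ∀ d ∈ ℬ h, e * d = d → d * e = d → ∃ μ : K, d = μ • u h := by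
    intro h d hd hed hde
    -- Multiplying by the inverse of `u h` reduces to degree one, where only scalars occur.
    obtain ⟨y, hy, h4, h5, h6, h7⟩ := he.exists_two_sided_inv (hu h) (h1 h) (h2 h) (h3 h)
    have hmem : d * y ∈ ℬ 1 := by
      have := hB.mul_mem hd hy
      rwa [mul_inv_cancel] at this
    obtain ⟨μ, hμ⟩ := he.exists_smul_eq hB hmem (by rw [← mul_assoc, hed]) (by rw [mul_assoc, h5])
    refine ⟨μ, ?_⟩
    rw [← hde, ← h6, ← mul_assoc, hμ, smul_mul_assoc, h1]
  have hα : ∀ a b : he.support hB, ∃ μ : Kˣ, u a * u b = (μ : K) • u (a * b) := by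
    intro a b
    obtain ⟨μ, hμ⟩ := hspan (a * b) (u a * u b) (hB.mul_mem (hu a) (hu b))
      (by rw [← mul_assoc, h1]) (by rw [mul_assoc, h2])
    refine ⟨Units.mk0 μ ?_, hμ⟩
    rintro rfl
    rw [zero_smul] at hμ
    exact he.mul_ne_zero (hu a) (h1 a) (h2 a) (h3 a) (h1 b) (h3 b) hμ
  choose α hα using hα
  refine ⟨he.support hB, ⟨α, fun a b c => ?_⟩, u, hu, h1, h2, h3, hα, ?_⟩
  -- The cocycle identity is associativity of `u a * u b * u c`.
  · ext
    rw [Units.val_mul, Units.val_mul]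
    apply smul_left_injective K (h3 (a * b * c))
    dsimp only
    rw [mul_smul, ← hα, ← smul_mul_assoc, ← hα, mul_assoc, mul_assoc, mul_smul,
      ← hα a, ← mul_smul_comm, ← hα]
  · intro g d hd hed hde hd0
    obtain ⟨μ, hμ⟩ := hspan ⟨g, d, hd, hed, hde, hd0⟩ d hd hed hde
    exact ⟨_, μ, rfl, hμ⟩

end IsGradedDivisionIdempotent

/-- Dual systems of homogeneous elements of `B * e` and `e * B`. -/
structure IsDualSystem (ℬ : G → Submodule K B) (e : B) {n : ℕ} (γ : Fin n → G) (v w : Fin n → B) :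
    Prop where
  v_mem : ∀ i, v i ∈ ℬ (γ i)⁻¹
  w_mem : ∀ i, w i ∈ ℬ (γ i)
  v_mul : ∀ i, v i * e = v i
  mul_w : ∀ i, e * w i = w i
  w_mul_v_self : ∀ i, w i * v i = e
  w_mul_v_of_ne : ∀ i j, i ≠ j → w i * v j = 0

namespace IsDualSystem

variable {n : ℕ} {γ : Fin n → G} {v w : Fin n → B} (hd : IsDualSystem ℬ e γ v w)
include hd

open Classical in
omit [IsScalarTower K B B] [SMulCommClass K B B] in
theorem w_mul_v (i j : Fin n) : w i * v j = if i = j then e else 0 := by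
  split_ifs with h
  · rw [h, hd.w_mul_v_self]
  · exact hd.w_mul_v_of_ne i j h

omit [IsScalarTower K B B] [SMulCommClass K B B] in
theorem sum_mul_v (j : Fin n) : (∑ i, v i * w i) * v j = v j := by
  classical
  simp_rw [Finset.sum_mul, mul_assoc, hd.w_mul_v]
  simp [hd.v_mul]

omit [IsScalarTower K B B] [SMulCommClass K B B] in
theorem w_mul_sum (j : Fin n) : w j * (∑ i, v i * w i) = w j := by
  classical
  simp_rw [Finset.mul_sum, ← mul_assoc, hd.w_mul_v]
  simp [hd.mul_w]

omit [IsScalarTower K B B] [SMulCommClass K B B] in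
theorem sum_mem (hB : IsGrading ℬ) : ∑ i, v i * w i ∈ ℬ 1 :=
  Submodule.sum_mem _ fun i _ => by
    have := hB.mul_mem (hd.v_mem i) (hd.w_mem i)
    rwa [inv_mul_cancel] at this

omit [IsScalarTower K B B] in
theorem le_finrank [FiniteDimensional K B] (he : IsGradedDivisionIdempotent ℬ e) :
    n ≤ Module.finrank K B := by
  classical
  have : LinearIndependent K v := by
    rw [Fintype.linearIndependent_iff]
    intro c hc i
    have h := congrArg (w i * ·) hc
    simp only [Finset.mul_sum, mul_smul_comm, hd.w_mul_v, smul_ite, smul_zero, mul_zero,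
      Finset.sum_ite_eq, Finset.mem_univ, if_true] at h
    exact (smul_eq_zero.1 h).resolve_right he.ne_zero
  simpa using this.fintype_card_le_finrank

/-- A Gram–Schmidt step. With `p = ∑ v i * w i` idempotent and not a left identity, some homogeneous
`x = b e - p b e` is nonzero. Some `e c x` is then nonzero, hence invertible in `e B e`, giving `y`
with `y * x = e`; replacing `y` by `y - y p` makes it kill the old `v j`. -/
theorem exists_cons [Finite G] (hB : IsGrading ℬ) (hs : IsGradedSimple ℬ)
    (he : IsGradedDivisionIdempotent ℬ e) (hp : ∃ b, (∑ i, v i * w i) * b ≠ b) :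
    ∃ (γ' : Fin (n + 1) → G) (v' w' : Fin (n + 1) → B), IsDualSystem ℬ e γ' v' w' := by
  set p := ∑ i, v i * w i with hpdef
  have hp1 : p ∈ ℬ 1 := hd.sum_mem hB
  have hwp : ∀ i, w i * p = w i := hd.w_mul_sum
  have hpv : ∀ j, p * v j = v j := hd.sum_mul_v
  have hpp : p * p = p :=
    calc p * p = ∑ i, v i * w i * p := Finset.sum_mul _ _ _
      _ = p := Finset.sum_congr rfl fun i _ => by rw [mul_assoc, hwp]
  obtain ⟨k, b, hb, hx0⟩ : ∃ k, ∃ b ∈ ℬ k, b * e - p * (b * e) ≠ 0 := by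
    by_contra! hc
    have hc : ∀ b, b * e - p * (b * e) = 0 := by
      intro b
      induction b using hB.induction with
      | hom g b hb => exact hc g b hb
      | zero => simp
      | add b c hb hc =>
        rw [add_mul, mul_add, add_sub_add_comm, hb, hc, add_zero]
    obtain ⟨b, hb⟩ := hp
    have hbm : b ∈ Submodule.span K {y | ∃ a b : B, y = a * e * b} := by
      rw [hs.span_mul_mul hB he.mem he.ne_zero]
      exact Submodule.mem_top
    apply hb
    clear hb
    induction hbm using Submodule.span_induction with
    | mem b hb =>
      obtain ⟨a, b, rfl⟩ := hb
      rw [← mul_assoc, ← sub_eq_zero.1 (hc a)]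
    | zero => rw [mul_zero]
    | add b c _ _ hb hc => rw [mul_add, hb, hc]
    | smul r b _ hb => rw [mul_smul_comm, hb]
  set x := b * e - p * (b * e) with hx
  have hbe : b * e ∈ ℬ k := by
    have := hB.mul_mem hb he.mem
    rwa [mul_one] at this
  have hxk : x ∈ ℬ k := by
    have := hB.mul_mem hp1 hbe
    rw [one_mul] at this
    exact Submodule.sub_mem _ hbe this
  have hxe : x * e = x := by
    rw [hx, sub_mul]
    simp only [mul_assoc, he.mul_self]
  have hpx : p * x = 0 := by
    rw [hx, mul_sub, ← mul_assoc p p, hpp, sub_self]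
  have hwx : ∀ i, w i * x = 0 := by
    intro i
    rw [← hwp i, mul_assoc, hpx, mul_zero]
  obtain ⟨l, c, hc, hcx⟩ : ∃ l, ∃ c ∈ ℬ l, e * c * x ≠ 0 := by
    by_contra! hc
    have hc : ∀ c, e * c * x = 0 := by
      intro c
      induction c using hB.induction with
      | hom g b hb => exact hc g b hb
      | zero => simp
      | add b c hb hc => rw [mul_add, add_mul, hb, hc, add_zero]
    refine hx0 (hs.eq_zero_of_mul_mul_mul hB he.mem he.ne_zero fun a b => ?_)
    rw [mul_assoc a, mul_assoc a, hc, mul_zero]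
  have hec : e * c ∈ ℬ l := by
    have := hB.mul_mem he.mem hc
    rwa [one_mul] at this
  obtain ⟨d, hdm, h1, h2, h3⟩ := he.exists_inv _ (e * c * x) (hB.mul_mem hec hxk)
    (by rw [← mul_assoc, ← mul_assoc, he.mul_self]) (by rw [mul_assoc, hxe]) hcx
  set y := d * c with hy
  have hyx : y * x = e := by
    rw [← h3, ← mul_assoc, ← mul_assoc, h2]
  have hyk : y ∈ ℬ k⁻¹ := by
    have := hB.mul_mem hdm hc
    rwa [mul_inv_rev, mul_assoc, inv_mul_cancel, mul_one] at this
  have hey : e * y = y := by rw [hy, ← mul_assoc, h1]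
  have hzk : y - y * p ∈ ℬ k⁻¹ := by
    have := hB.mul_mem hyk hp1
    rw [mul_one] at this
    exact Submodule.sub_mem _ hyk this
  refine ⟨Fin.cons k⁻¹ γ, Fin.cons x v, Fin.cons (y - y * p) w, ?_, ?_, ?_, ?_, ?_, ?_⟩
  · intro i
    refine Fin.cases ?_ (fun i => ?_) i
    · simpa using hxk
    · simpa using hd.v_mem i
  · intro i
    refine Fin.cases ?_ (fun i => ?_) i
    · simpa using hzk
    · simpa using hd.w_mem i
  · intro i
    refine Fin.cases ?_ (fun i => ?_) i
    · simpa using hxe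
    · simpa using hd.v_mul i
  · intro i
    refine Fin.cases ?_ (fun i => ?_) i
    · simp [mul_sub, ← mul_assoc, hey]
    · simpa using hd.mul_w i
  · intro i
    refine Fin.cases ?_ (fun i => ?_) i
    · simp [sub_mul, mul_assoc, hpx, hyx]
    · simpa using hd.w_mul_v_self i
  · intro i j
    refine Fin.cases ?_ (fun i => ?_) i <;> refine Fin.cases ?_ (fun j => ?_) j <;> intro hij
    · exact absurd rfl hij
    · simp only [Fin.cons_zero, Fin.cons_succ]
      rw [sub_mul, mul_assoc y p, hpv, sub_self]
    · simpa using hwx i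
    · simpa using hd.w_mul_v_of_ne i j fun h => hij (congrArg _ h)

end IsDualSystem

/-- Extension must stop, since the `v i` are linearly independent. A left identity is then also a
right identity, because no nonzero element is killed by all right multiplications. -/
theorem IsGradedDivisionIdempotent.exists_complete_dualSystem [Finite G] [FiniteDimensional K B]
    (he : IsGradedDivisionIdempotent ℬ e) (hB : IsGrading ℬ) (hs : IsGradedSimple ℬ) :
    ∃ (n : ℕ) (γ : Fin n → G) (v w : Fin n → B), 0 < n ∧ IsDualSystem ℬ e γ v w ∧
      (∀ b, (∑ i, v i * w i) * b = b) ∧ ∀ b, b * (∑ i, v i * w i) = b := by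
  obtain ⟨n, γ, v, w, hd, hp⟩ : ∃ (n : ℕ) (γ : Fin n → G) (v w : Fin n → B),
      IsDualSystem ℬ e γ v w ∧ ∀ b, (∑ i, v i * w i) * b = b := by
    by_contra! hc
    have hall : ∀ n : ℕ, ∃ (γ : Fin n → G) (v w : Fin n → B), IsDualSystem ℬ e γ v w := by
      intro n
      induction n with
      | zero =>
        exact ⟨Fin.elim0, Fin.elim0, Fin.elim0, fun i => i.elim0, fun i => i.elim0, fun i => i.elim0,
          fun i => i.elim0, fun i => i.elim0, fun i => i.elim0⟩
      | succ n ih =>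
        obtain ⟨γ, v, w, hd⟩ := ih
        exact hd.exists_cons hB hs he (hc n γ v w hd)
    obtain ⟨γ, v, w, hd⟩ := hall (Module.finrank K B + 1)
    exact absurd (hd.le_finrank he) (by omega)
  refine ⟨n, γ, v, w, ?_, hd, hp, fun b => ?_⟩
  · rcases Nat.eq_zero_or_pos n with rfl | hn
    · exact absurd (hp e).symm (by simpa using he.ne_zero)
    · exact hn
  · rw [← sub_eq_zero]
    refine hs.eq_zero_of_mul_right hB fun c => ?_
    rw [sub_mul, mul_assoc, hp, sub_self]

end GradedDivision

namespace TwistedGroupAlgebra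

variable {H : Type*} {K : Type*} [Group H] [Field K] (α : TwoCocycle H K)

/-- The basis `u_h`. -/
def basis : Module.Basis H K (TwistedGroupAlgebra α) :=
  Module.Basis.ofRepr (M := TwistedGroupAlgebra α)
    { toFun := fun f => (f : H →₀ K)
      invFun := fun f => f
      map_add' := fun _ _ => rfl
      map_smul' := fun _ _ => rfl
      left_inv := fun _ => rfl
      right_inv := fun _ => rfl }

theorem basis_apply (h : H) : basis α h = single α h 1 := rfl

end TwistedGroupAlgebra

/-! ### The structure theorem over an algebraically closed field. -/

section Structure

variable {K : Type*} {G : Type*} {B : Type*} [Field K] [Group G] [NonUnitalRing B] [Module K B]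
  [IsScalarTower K B B] [SMulCommClass K B B] {ℬ : G → Submodule K B}

/-- A finite-dimensional graded simple algebra over an algebraically closed field is a matrix
algebra over a twisted group algebra, with an elementary grading. -/
theorem IsGradedSimple.exists_equiv_matrix [Finite G] [IsAlgClosed K] [FiniteDimensional K B]
    (hB : IsGrading ℬ) (hs : IsGradedSimple ℬ) :
    ∃ (H : Subgroup G) (α : TwoCocycle H K) (n : ℕ) (_ : 0 < n) (γ : Fin n → G)
      (ψ : TwistedGroupAlgebra α ⊗[K] Matrix (Fin n) (Fin n) K ≃ₗ[K] B),
      (∀ x y, ψ (x * y) = ψ x * ψ y) ∧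
      ∀ g y, y ∈ matrixGrading (twistedGrading α) γ g ↔ ψ y ∈ ℬ g := by
  classical
  cases nonempty_fintype G
  obtain ⟨e, he⟩ := hs.exists_divisionIdempotent hB
  obtain ⟨H, α, u, hu, h1, h2, h3, hα, hspan⟩ := he.exists_twisted_basis hB
  obtain ⟨n, γ, v, w, hn, hd, hpl, hpr⟩ := he.exists_complete_dualSystem hB hs
  -- The counterpart in `B` of `u_h ⊗ e_{ij}`.
  let β : H × (Fin n × Fin n) → B := fun p => v p.2.1 * u p.1 * w p.2.2
  have hβmem : ∀ p : H × (Fin n × Fin n), β p ∈ ℬ ((γ p.2.1)⁻¹ * p.1 * γ p.2.2) := fun p =>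
    hB.mul_mem (hB.mul_mem (hd.v_mem _) (hu _)) (hd.w_mem _)
  have hcoord : ∀ i j p, w i * β p * v j = if p.2 = (i, j) then u p.1 else 0 := by
    rintro i j ⟨h, i', j'⟩
    have : w i * β (h, i', j') * v j = w i * v i' * u h * (w j' * v j) := by
      simp only [β, mul_assoc]
    rw [this, hd.w_mul_v, hd.w_mul_v]
    by_cases hi : i = i'
    · by_cases hj : j' = j
      · simp [hi, hj, h1, h2]
      · simp [hj]
    · simp [hi, Ne.symm hi]
  have hli : LinearIndependent K β := by
    rw [Fintype.linearIndependent_iff]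
    rintro c hc ⟨h, i, j⟩
    -- Sandwiching between `w i` and `v j` isolates the matrix position, and the projection to
    -- degree `h` isolates the group element.
    have hc := congrArg (fun x => hB.proj h (w i * x * v j)) hc
    simp only [Finset.mul_sum, Finset.sum_mul, mul_smul_comm, smul_mul_assoc, hcoord, mul_zero,
      zero_mul, map_zero, map_sum, map_smul] at hc
    rw [Finset.sum_eq_single (h, i, j)] at hc
    · rw [if_pos rfl, hB.proj_of_mem (hu h)] at hc
      exact (smul_eq_zero.1 hc).resolve_right (h3 h)
    · rintro ⟨h', i', j'⟩ _ hne
      split_ifs with heq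
      · rw [hB.proj_of_ne (hu h'), smul_zero]
        intro hh
        apply hne
        simp only at heq
        rw [Subtype.ext hh, heq]
      · simp
    · intro h
      exact absurd (Finset.mem_univ _) h
  have hexp : ∀ g, ∀ b ∈ ℬ g, b ∈ Submodule.span K
      (β '' {p | (γ p.2.1)⁻¹ * p.1 * γ p.2.2 = g}) := by
    intro g b hb
    -- Insert the identity `∑ v i * w i` on both sides. The middle factor is homogeneous in `e B e`,
    -- so it is zero or a multiple of one `u h`.
    have : b = ∑ i, ∑ j, v i * (w i * b * v j) * w j := by
      conv_lhs => rw [← hpl b, ← hpr ((∑ i, v i * w i) * b)]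
      simp_rw [Finset.sum_mul, Finset.mul_sum, mul_assoc]
    rw [this]
    refine Submodule.sum_mem _ fun i _ => Submodule.sum_mem _ fun j _ => ?_
    by_cases h0 : w i * b * v j = 0
    · rw [h0, mul_zero, zero_mul]
      exact Submodule.zero_mem _
    · obtain ⟨h, μ, hh, hμ⟩ := hspan _ _ (hB.mul_mem (hB.mul_mem (hd.w_mem i) hb) (hd.v_mem j))
        (by rw [← mul_assoc, ← mul_assoc, hd.mul_w]) (by rw [mul_assoc, hd.v_mul]) h0
      rw [hμ, mul_smul_comm, smul_mul_assoc]
      refine Submodule.smul_mem _ _ (Submodule.subset_span ⟨(h, i, j), ?_, rfl⟩)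
      simp only [Set.mem_ofPred_eq, hh]
      group
  have hsp : ⊤ ≤ Submodule.span K (Set.range β) := by
    intro b _
    rw [← hB.sum_proj b]
    exact Submodule.sum_mem _ fun g _ =>
      Submodule.span_mono (Set.image_subset_range _ _) (hexp g _ (hB.proj_mem g b))
  let bB := Module.Basis.mk hli hsp
  let bT := (TwistedGroupAlgebra.basis α).tensorProduct (Matrix.stdBasis K (Fin n) (Fin n))
  have hbT : ∀ h i j, bT (h, i, j) =
      TwistedGroupAlgebra.single α h 1 ⊗ₜ[K] Matrix.single i j (1 : K) := by
    intro h i j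
    rw [Module.Basis.tensorProduct_apply, TwistedGroupAlgebra.basis_apply,
      Matrix.stdBasis_eq_single]
  let ψ := bT.equiv bB (Equiv.refl _)
  have hψ : ∀ p, ψ (bT p) = β p := by
    intro p
    rw [Module.Basis.equiv_apply, Equiv.refl_apply, Module.Basis.mk_apply]
  refine ⟨H, α, n, hn, γ, ψ, ?_, ?_⟩
  · have : (LinearMap.mul K _).compr₂ ψ.toLinearMap =
        (LinearMap.mul K B).compl₁₂ ψ.toLinearMap ψ.toLinearMap := by
      refine bT.ext fun p => bT.ext fun q => ?_
      obtain ⟨h, i, j⟩ := p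
      obtain ⟨h', k, l⟩ := q
      simp only [LinearMap.compr₂_apply, LinearMap.compl₁₂_apply, LinearMap.mul_apply',
        LinearEquiv.coe_coe, hψ]
      have hR : β (h, i, j) * β (h', k, l) = v i * u h * (w j * v k) * (u h' * w l) := by
        simp only [β, mul_assoc]
      rw [hR, hd.w_mul_v, hbT, hbT, Algebra.TensorProduct.tmul_mul_tmul,
        TwistedGroupAlgebra.single_mul_single, one_mul, one_mul]
      split_ifs with hjk
      · subst hjk
        have h4 : TwistedGroupAlgebra.single α (h * h') (α.toFun h h' : K) =
            (α.toFun h h' : K) • TwistedGroupAlgebra.single α (h * h') 1 := by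
          rw [TwistedGroupAlgebra.smul_single, smul_eq_mul, mul_one]
        rw [Matrix.single_mul_single_same, one_mul, h4, ← TensorProduct.smul_tmul', map_smul,
          ← hbT, hψ, mul_assoc (v i), h2, ← mul_assoc, mul_assoc (v i), hα, mul_smul_comm,
          smul_mul_assoc]
      · rw [Matrix.single_mul_single_of_ne _ _ _ _ hjk, TensorProduct.tmul_zero, map_zero, mul_zero,
          zero_mul]
    intro x y
    exact LinearMap.congr_fun (LinearMap.congr_fun this x) y
  · intro g y
    constructor
    · intro hy
      induction hy using Submodule.span_induction with
      | mem y hy =>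
        obtain ⟨i, j, h, b, hb, rfl, rfl⟩ := hy
        induction hb using Submodule.span_induction with
        | mem b hb =>
          obtain ⟨h, rfl, rfl⟩ := hb
          rw [← hbT, hψ]
          exact hβmem (h, i, j)
        | zero => rw [TensorProduct.zero_tmul, map_zero]; exact Submodule.zero_mem _
        | add b c _ _ hb hc => rw [TensorProduct.add_tmul, map_add]; exact Submodule.add_mem _ hb hc
        | smul r b _ hb =>
          rw [← TensorProduct.smul_tmul', map_smul]; exact Submodule.smul_mem _ r hb
      | zero => rw [map_zero]; exact Submodule.zero_mem _
      | add y z _ _ hy hz => rw [map_add]; exact Submodule.add_mem _ hy hz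
      | smul r y _ hy => rw [map_smul]; exact Submodule.smul_mem _ r hy
    · intro hy
      have h4 := hexp g _ hy
      have h5 : Submodule.span K (β '' {p | (γ p.2.1)⁻¹ * p.1 * γ p.2.2 = g}) ≤
          (matrixGrading (twistedGrading α) γ g).map ψ.toLinearMap := by
        rw [Submodule.span_le]
        rintro _ ⟨⟨h, i, j⟩, hp, rfl⟩
        refine ⟨bT (h, i, j), ?_, hψ _⟩
        rw [hbT]
        exact Submodule.subset_span ⟨i, j, h, _, Submodule.subset_span ⟨h, rfl, rfl⟩, hp.symm, rfl⟩
      obtain ⟨z, hz, hzy⟩ := h5 h4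
      rwa [← ψ.injective hzy]

end Structure

/-! ### Extension of scalars from the centroid. -/

section BaseChange

theorem iSupIndep_of_projections {K G B : Type*} [Field K] [AddCommGroup B] [Module K B]
    {ℬ : G → Submodule K B} (P : G → B →ₗ[K] B) (h1 : ∀ g, ∀ x ∈ ℬ g, P g x = x)
    (h2 : ∀ g k, g ≠ k → ∀ x ∈ ℬ g, P k x = 0) : iSupIndep ℬ := by
  rw [iSupIndep_def]
  intro g
  rw [Submodule.disjoint_def]
  intro x hx hx'
  have hle : ⨆ j, ⨆ (_ : j ≠ g), ℬ j ≤ LinearMap.ker (P g) :=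
    iSup₂_le fun j hj x hx => h2 j g hj x hx
  rw [← h1 g x hx]
  exact hle hx'

theorem IsGradedIdeal.proj_mem {F G A : Type*} [Field F] [Group G] [NonUnitalRing A] [Module F A]
    {𝒜 : G → Submodule F A} (h : IsGrading 𝒜) {I : Submodule F A} (hI : IsGradedIdeal 𝒜 I) (g : G)
    {x : A} (hx : x ∈ I) : h.proj g x ∈ I := by
  classical
  rw [hI.graded] at hx
  refine Submodule.iSup_induction _ (motive := fun x => h.proj g x ∈ I) hx (fun k x hx => ?_)
    (by simp) fun x y hx hy => by rw [map_add]; exact I.add_mem hx hy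
  rw [h.proj_eq_ite hx.2]
  split_ifs
  · exact hx.1
  · exact I.zero_mem

variable {F : Type*} {G : Type*} {A : Type*} [Field F] [Group G] [NonUnitalRing A] [Module F A]
  [IsScalarTower F A A] [SMulCommClass F A A] {𝒜 : G → Submodule F A} {h : IsGrading 𝒜}
  {C : Type*} [Field C] [Module C A]

namespace IsDenseCentroid

/-- An element of the multiplication algebra, as a linear map over the centroid. -/
def toLinearMap (hC : IsDenseCentroid h C) {m : Module.End F A} (hm : m ∈ h.multAlg) : A →ₗ[C] A where
  toFun := m
  map_add' := map_add m
  map_smul' c x := hC.comm m hm c x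

theorem toLinearMap_apply (hC : IsDenseCentroid h C) {m : Module.End F A} (hm : m ∈ h.multAlg)
    (x : A) : hC.toLinearMap hm x = m x := rfl

theorem isGrading_component (hC : IsDenseCentroid h C) : IsGrading hC.component where
  indep := iSupIndep_of_projections (fun g => hC.toLinearMap (h.proj_mem_multAlg g))
    (fun g x hx => h.proj_of_mem hx) fun g k hgk x hx => h.proj_of_ne hx hgk
  iSup_eq_top := by
    rw [eq_top_iff]
    intro a _
    induction a using h.induction with
    | hom g x hx => exact Submodule.mem_iSup_of_mem (p := hC.component) g hx
    | zero => exact Submodule.zero_mem _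
    | add x y hx hy => exact Submodule.add_mem _ (hx trivial) (hy trivial)
  mul_mem := h.mul_mem

variable (K : Type*) [Field K] [Algebra C K]

/-- The grading of the scalar extension. -/
def baseChange (_hC : IsDenseCentroid h C) (g : G) : Submodule K (K ⊗[C] A) :=
  Submodule.span K ((fun a : A => (1 : K) ⊗ₜ[C] a) '' 𝒜 g)

variable [IsScalarTower C A A] [SMulCommClass C A A]

omit [IsScalarTower C A A] [SMulCommClass C A A] in
theorem baseChange_proj_of_mem [DecidableEq G] (hC : IsDenseCentroid h C) {g : G} {x : K ⊗[C] A}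
    (hx : x ∈ hC.baseChange K g) (k : G) :
    (hC.toLinearMap (h.proj_mem_multAlg k)).baseChange K x = if g = k then x else 0 := by
  induction hx using Submodule.span_induction with
  | mem x hx =>
    obtain ⟨a, ha, rfl⟩ := hx
    rw [LinearMap.baseChange_tmul, toLinearMap_apply, h.proj_eq_ite ha]
    split_ifs <;> simp
  | zero => simp
  | add x y _ _ hx hy => rw [map_add, hx, hy]; split_ifs <;> simp
  | smul r x _ hx => rw [map_smul, hx]; split_ifs <;> simp

theorem isGrading_baseChange (hC : IsDenseCentroid h C) : IsGrading (hC.baseChange K) where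
  indep := by
    classical
    refine iSupIndep_of_projections
      (fun g => (hC.toLinearMap (h.proj_mem_multAlg g)).baseChange K) ?_ ?_
    · intro g x hx
      rw [hC.baseChange_proj_of_mem K hx, if_pos rfl]
    · intro g k hgk x hx
      rw [hC.baseChange_proj_of_mem K hx, if_neg hgk]
  iSup_eq_top := by
    rw [eq_top_iff]
    intro x _
    induction x using TensorProduct.induction_on with
    | zero => exact Submodule.zero_mem _
    | tmul r a =>
      induction a using h.induction with
      | hom g a ha =>
        refine Submodule.mem_iSup_of_mem g ?_
        rw [← mul_one r, ← smul_eq_mul, ← TensorProduct.smul_tmul']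
        exact Submodule.smul_mem _ r (Submodule.subset_span ⟨a, ha, rfl⟩)
      | zero => rw [TensorProduct.tmul_zero]; exact Submodule.zero_mem _
      | add a b ha hb => rw [TensorProduct.tmul_add]; exact Submodule.add_mem _ (ha trivial) (hb trivial)
    | add x y hx hy => exact Submodule.add_mem _ (hx trivial) (hy trivial)
  mul_mem := by
    intro g k x y hx hy
    induction hx using Submodule.span_induction with
    | mem x hx =>
      obtain ⟨a, ha, rfl⟩ := hx
      induction hy using Submodule.span_induction with
      | mem y hy =>
        obtain ⟨b, hb, rfl⟩ := hy
        rw [Algebra.TensorProduct.tmul_mul_tmul, one_mul]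
        exact Submodule.subset_span ⟨_, h.mul_mem ha hb, rfl⟩
      | zero => rw [mul_zero]; exact Submodule.zero_mem _
      | add y z _ _ hy hz => rw [mul_add]; exact Submodule.add_mem _ hy hz
      | smul r y _ hy => rw [mul_smul_comm]; exact Submodule.smul_mem _ r hy
    | zero => rw [zero_mul]; exact Submodule.zero_mem _
    | add x z _ _ hx hz => rw [add_mul]; exact Submodule.add_mem _ hx hz
    | smul r x _ hx => rw [smul_mul_assoc]; exact Submodule.smul_mem _ r hx

theorem proj_baseChange (hC : IsDenseCentroid h C) (g : G) (x : K ⊗[C] A) :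
    (hC.toLinearMap (h.proj_mem_multAlg g)).baseChange K x =
      (hC.isGrading_baseChange K).proj g x := by
  classical
  induction x using (hC.isGrading_baseChange K).induction with
  | hom k x hx => rw [hC.baseChange_proj_of_mem K hx, (hC.isGrading_baseChange K).proj_eq_ite hx]
  | zero => simp
  | add x y hx hy => rw [map_add, map_add, hx, hy]

/-- It is enough to check generators of the multiplication algebra: multiplications extend to
multiplications by `1 ⊗ a`, and projections to projections. -/
theorem baseChange_mem_of_isGradedIdeal [Algebra F C] [IsScalarTower F C A]
    (hC : IsDenseCentroid h C) {I : Submodule K (K ⊗[C] A)}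
    (hI : IsGradedIdeal (hC.baseChange K) I) {m : Module.End F A} (hm : m ∈ h.multAlg)
    {x : K ⊗[C] A} (hx : x ∈ I) : (hC.toLinearMap hm).baseChange K x ∈ I := by
  induction hm using Algebra.adjoin_induction generalizing x with
  | mem m hm =>
    rcases hm with (⟨a, rfl⟩ | ⟨a, rfl⟩) | ⟨g, rfl⟩
    · have : ∀ x, (hC.toLinearMap (h.mulLeft_mem a)).baseChange K x = (1 : K) ⊗ₜ[C] a * x := by
        intro x
        induction x using TensorProduct.induction_on with
        | zero => simp
        | tmul r b =>
          rw [LinearMap.baseChange_tmul, toLinearMap_apply, Algebra.TensorProduct.tmul_mul_tmul,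
            one_mul, LinearMap.mulLeft_apply]
        | add x y hx hy => rw [map_add, hx, hy, mul_add]
      exact (this x).symm ▸ hI.mul_mem_left _ hx
    · have : ∀ x, (hC.toLinearMap (h.mulRight_mem a)).baseChange K x = x * (1 : K) ⊗ₜ[C] a := by
        intro x
        induction x using TensorProduct.induction_on with
        | zero => simp
        | tmul r b =>
          rw [LinearMap.baseChange_tmul, toLinearMap_apply, Algebra.TensorProduct.tmul_mul_tmul,
            mul_one, LinearMap.mulRight_apply]
        | add x y hx hy => rw [map_add, hx, hy, add_mul]
      exact (this x).symm ▸ hI.mul_mem_right _ hx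
    · rw [hC.proj_baseChange K g x]
      exact hI.proj_mem _ g hx
  | algebraMap r =>
    have : hC.toLinearMap (h.multAlg.algebraMap_mem r) = algebraMap F C r • LinearMap.id := by
      ext a
      rw [toLinearMap_apply, Module.algebraMap_end_apply, LinearMap.smul_apply, LinearMap.id_apply,
        algebraMap_smul]
    have h2 : (hC.toLinearMap (h.multAlg.algebraMap_mem r)).baseChange K x =
        algebraMap C K (algebraMap F C r) • x := by
      rw [this, LinearMap.baseChange_smul, LinearMap.baseChange_id, LinearMap.smul_apply,
        LinearMap.id_apply, algebraMap_smul K (algebraMap F C r) x]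
    exact h2.symm ▸ I.smul_mem _ hx
  | add m n hm hn ihm ihn =>
    have : hC.toLinearMap (h.multAlg.add_mem hm hn) = hC.toLinearMap hm + hC.toLinearMap hn := rfl
    have h2 : (hC.toLinearMap (h.multAlg.add_mem hm hn)).baseChange K x =
        (hC.toLinearMap hm).baseChange K x + (hC.toLinearMap hn).baseChange K x := by
      rw [this, LinearMap.baseChange_add, LinearMap.add_apply]
    exact h2.symm ▸ I.add_mem (ihm hx) (ihn hx)
  | mul m n hm hn ihm ihn =>
    have : hC.toLinearMap (h.multAlg.mul_mem hm hn) = hC.toLinearMap hm ∘ₗ hC.toLinearMap hn := rfl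
    have h2 : (hC.toLinearMap (h.multAlg.mul_mem hm hn)).baseChange K x =
        (hC.toLinearMap hm).baseChange K ((hC.toLinearMap hn).baseChange K x) := by
      rw [this, LinearMap.baseChange_comp, LinearMap.comp_apply]
    exact h2.symm ▸ ihm (ihn hx)

/-- In finite dimension, density realizes every elementary operator on a `C`-basis within the
multiplication algebra. Its extension preserves graded ideals, so one nonzero coordinate of one
element of `I` puts every basis vector into `I`. -/
theorem isGradedSimple_baseChange [Algebra F C] [IsScalarTower F C A] [FiniteDimensional C A]
    (hC : IsDenseCentroid h C) (hs : IsGradedSimple 𝒜) : IsGradedSimple (hC.baseChange K) where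
  sq_ne_zero := by
    obtain ⟨a, b, hab⟩ := hs.sq_ne_zero
    refine ⟨1 ⊗ₜ a, 1 ⊗ₜ b, fun h0 => hab ?_⟩
    rw [Algebra.TensorProduct.tmul_mul_tmul, one_mul] at h0
    let e := Module.finBasis C A
    apply e.repr.injective
    ext i
    have := congrArg (fun x => (e.baseChange K).repr x i) h0
    simp only [Module.Basis.baseChange_repr_tmul, map_zero, Finsupp.zero_apply,
      Algebra.smul_def, mul_one] at this
    rw [map_zero, Finsupp.zero_apply]
    exact (algebraMap C K).injective (by rw [this, map_zero])
  eq_bot_or_eq_top := by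
    classical
    intro I hI
    refine or_iff_not_imp_left.2 fun hne => ?_
    obtain ⟨x, hx, hx0⟩ := (Submodule.ne_bot_iff I).1 hne
    let e := Module.finBasis C A
    let eK := e.baseChange K
    obtain ⟨i, hi⟩ : ∃ i, eK.repr x i ≠ 0 := by
      by_contra! hc
      exact hx0 (eK.repr.injective (by ext i; simp [hc]))
    have hmem : ∀ j, eK j ∈ I := by
      intro j
      let f : A →ₗ[C] A := e.constr C fun k => if k = i then e j else 0
      have hf : ∀ k, f (e k) = if k = i then e j else 0 := fun k => e.constr_basis C _ k
      obtain ⟨m, hm, hfm⟩ := hC.dense f (Finset.univ.image e)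
      have hfm' : f = hC.toLinearMap hm := e.ext fun k =>
        hfm _ (Finset.mem_image_of_mem e (Finset.mem_univ k))
      have h1 := hC.baseChange_mem_of_isGradedIdeal K hI hm hx
      rw [← hfm', ← eK.sum_repr x, map_sum, Finset.sum_eq_single i] at h1
      · rw [map_smul, Module.Basis.baseChange_apply, LinearMap.baseChange_tmul, hf, if_pos rfl] at h1
        have h2 := I.smul_mem (eK.repr x i)⁻¹ h1
        rwa [inv_smul_smul₀ hi, ← Module.Basis.baseChange_apply] at h2
      · intro k _ hk
        rw [map_smul, Module.Basis.baseChange_apply, LinearMap.baseChange_tmul, hf, if_neg hk,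
          TensorProduct.tmul_zero, smul_zero]
      · intro h
        exact absurd (Finset.mem_univ _) h
    rw [eq_top_iff, ← eK.span_eq, Submodule.span_le]
    rintro _ ⟨j, rfl⟩
    exact hmem j

end IsDenseCentroid

end BaseChange

/-! ### Generic homogeneous elements and transfer of identities. -/

section GenericEvaluation

open Finset

variable {F : Type*} {G : Type*} {C : Type*} {L : Type*} {D : Type*} {ι : Type*}
  [Field F] [Field C] [Field L] [NonUnitalRing D]
  [Algebra F C] [Algebra F L] [Algebra C L] [IsScalarTower F C L]
  [Module F D] [IsScalarTower F D D] [SMulCommClass F D D]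
  [Module L D] [IsScalarTower F L D] [IsScalarTower L D D] [SMulCommClass L D D]
  [Fintype ι]

open Classical in
/-- On the generic homogeneous elements with respect to the basis `β`, the polynomial `f` takes the
value `κ + ∑ i, P i • β i`. -/
def IsGenericValue (deg : ι → G) (β : ι → D) (f : FreeAlgebra F (ℕ × G)) (κ : F)
    (P : ι → MvPolynomial ((ℕ × G) × ι) C) : Prop :=
  ∀ t : (ℕ × G) × ι → L,
    evalPoly F (fun x => ∑ i, (if deg i = x.2 then t (x, i) else 0) • β i) f =
      Unitization.inl κ + Unitization.inr (∑ i, MvPolynomial.aeval t (P i) • β i)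

variable (C) (L)

omit [IsScalarTower F C L] [IsScalarTower F L D] [IsScalarTower L D D] [SMulCommClass L D D]
  [Algebra F C] [Algebra F L] in
theorem isGenericValue_algebraMap (deg : ι → G) (β : ι → D) (r : F) :
    IsGenericValue (C := C) (L := L) deg β (algebraMap F _ r) r 0 := by
  intro t
  simp [evalPoly, Unitization.algebraMap_eq_inl]

open Classical in
omit [IsScalarTower F C L] [IsScalarTower F L D] [IsScalarTower L D D] [SMulCommClass L D D]
  [Algebra F C] [Algebra F L] in
theorem isGenericValue_ι (deg : ι → G) (β : ι → D) (x : ℕ × G) :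
    IsGenericValue (C := C) (L := L) deg β (FreeAlgebra.ι F x) 0
      (fun i => if deg i = x.2 then MvPolynomial.X (x, i) else 0) := by
  intro t
  simp only [evalPoly, FreeAlgebra.lift_ι_apply, Unitization.inl_zero, zero_add]
  congr 1
  refine sum_congr rfl fun i _ => ?_
  split_ifs <;> simp

variable {C} {L}

omit [IsScalarTower F C L] [IsScalarTower F L D] [IsScalarTower L D D] [SMulCommClass L D D]
  [Algebra F C] [Algebra F L] in
theorem IsGenericValue.add {deg : ι → G} {β : ι → D} {f g : FreeAlgebra F (ℕ × G)} {κ κ' : F}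
    {P Q : ι → MvPolynomial ((ℕ × G) × ι) C} (hf : IsGenericValue (L := L) deg β f κ P)
    (hg : IsGenericValue (L := L) deg β g κ' Q) :
    IsGenericValue (L := L) deg β (f + g) (κ + κ') (P + Q) := by
  intro t
  have h1 := hf t
  have h2 := hg t
  simp only [evalPoly] at h1 h2 ⊢
  rw [map_add, h1, h2, Unitization.inl_add, add_add_add_comm, ← Unitization.inr_add,
    ← sum_add_distrib]
  simp only [Pi.add_apply, map_add, add_smul]

theorem IsGenericValue.mul {deg : ι → G} {β : ι → D} {s : ι → ι → ι → C}
    (hβ : ∀ i j, β i * β j = ∑ k, algebraMap C L (s i j k) • β k)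
    {f g : FreeAlgebra F (ℕ × G)} {κ κ' : F}
    {P Q : ι → MvPolynomial ((ℕ × G) × ι) C} (hf : IsGenericValue (L := L) deg β f κ P)
    (hg : IsGenericValue (L := L) deg β g κ' Q) :
    IsGenericValue (L := L) deg β (f * g) (κ * κ') (fun k =>
      MvPolynomial.C (algebraMap F C κ) * Q k + MvPolynomial.C (algebraMap F C κ') * P k +
        ∑ i, ∑ j, MvPolynomial.C (s i j k) * (P i * Q j)) := by
  intro t
  have h1 := hf t
  have h2 := hg t
  simp only [evalPoly] at h1 h2 ⊢
  rw [map_mul, h1, h2]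
  ext
  · simp
  · simp only [Unitization.snd_mul, Unitization.snd_add, Unitization.snd_inl, Unitization.snd_inr,
      Unitization.fst_add, Unitization.fst_inl, Unitization.fst_inr, add_zero, zero_add,
      map_add, map_mul, map_sum, MvPolynomial.aeval_C, add_smul, sum_add_distrib,
      ← IsScalarTower.algebraMap_apply F C L]
    congr 1
    · simp only [mul_smul, ← smul_sum, algebraMap_smul]
    · simp_rw [sum_smul]
      rw [sum_mul_sum]
      symm
      rw [sum_comm]
      refine sum_congr rfl fun i _ => ?_
      rw [sum_comm]
      refine sum_congr rfl fun j _ => ?_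
      rw [smul_mul_smul_comm, hβ, smul_sum]
      refine sum_congr rfl fun k _ => ?_
      rw [smul_smul, mul_comm]

/-- The coordinates are computed from the structure constants alone, so algebras over different
extensions of `C` with the same constants share `κ` and `P`. -/
theorem exists_isGenericValue {L' D' : Type*} [Field L'] [NonUnitalRing D'] [Algebra F L']
    [Algebra C L'] [IsScalarTower F C L'] [Module F D'] [IsScalarTower F D' D']
    [SMulCommClass F D' D'] [Module L' D'] [IsScalarTower F L' D'] [IsScalarTower L' D' D']
    [SMulCommClass L' D' D'] (deg : ι → G) {s : ι → ι → ι → C} {β : ι → D} {β' : ι → D'}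
    (hβ : ∀ i j, β i * β j = ∑ k, algebraMap C L (s i j k) • β k)
    (hβ' : ∀ i j, β' i * β' j = ∑ k, algebraMap C L' (s i j k) • β' k)
    (f : FreeAlgebra F (ℕ × G)) :
    ∃ (κ : F) (P : ι → MvPolynomial ((ℕ × G) × ι) C),
      IsGenericValue (L := L) deg β f κ P ∧ IsGenericValue (L := L') deg β' f κ P := by
  induction f using FreeAlgebra.induction with
  | grade0 r => exact ⟨r, 0, isGenericValue_algebraMap C L deg β r,
      isGenericValue_algebraMap C L' deg β' r⟩
  | grade1 x => exact ⟨_, _, isGenericValue_ι C L deg β x, isGenericValue_ι C L' deg β' x⟩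
  | mul f g hf hg =>
    obtain ⟨κ, P, h1, h2⟩ := hf
    obtain ⟨κ', Q, h3, h4⟩ := hg
    exact ⟨_, _, h1.mul hβ h3, h2.mul hβ' h4⟩
  | add f g hf hg =>
    obtain ⟨κ, P, h1, h2⟩ := hf
    obtain ⟨κ', Q, h3, h4⟩ := hg
    exact ⟨_, _, h1.add h3, h2.add h4⟩

omit [IsScalarTower F C L] [IsScalarTower F L D] [IsScalarTower L D D] [SMulCommClass L D D]
  [Algebra F C] [Algebra F L] in
-- Specializing the generic elements yields every homogeneous substitution, and over an infinite
-- field a polynomial vanishing at all points is zero.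
theorem IsGenericValue.mem_gradedIdentities_iff [Infinite L] {𝒟 : G → Submodule F D} {deg : ι → G}
    {β : Module.Basis ι L D} {f : FreeAlgebra F (ℕ × G)} {κ : F}
    {P : ι → MvPolynomial ((ℕ × G) × ι) C} (hf : IsGenericValue (L := L) deg β f κ P)
    (hdeg : ∀ i (r : L), r • β i ∈ 𝒟 (deg i))
    (hrepr : ∀ g, ∀ y ∈ 𝒟 g, ∀ i, deg i ≠ g → β.repr y i = 0) :
    f ∈ gradedIdentities F 𝒟 ↔ κ = 0 ∧ ∀ i, P i = 0 := by
  classical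
  constructor
  · intro h
    have h0 : ∀ t : (ℕ × G) × ι → L, κ = 0 ∧ ∑ i, MvPolynomial.aeval t (P i) • β i = 0 := by
      intro t
      have h1 := hf t
      rw [h _ ?_] at h1
      · have h2 := congrArg (fun x => x.fst) h1
        have h3 := congrArg (fun x => x.snd) h1
        simp only [Unitization.fst_add, Unitization.fst_inl, Unitization.fst_inr, add_zero,
          Unitization.fst_zero] at h2
        simp only [Unitization.snd_add, Unitization.snd_inl, Unitization.snd_inr, zero_add,
          Unitization.snd_zero] at h3
        exact ⟨h2.symm, h3.symm⟩
      · intro i g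
        refine Submodule.sum_mem _ fun j _ => ?_
        split_ifs with hj
        · rw [← show deg j = g from hj]
          exact hdeg j _
        · rw [zero_smul]
          exact Submodule.zero_mem _
    refine ⟨(h0 0).1, fun i => ?_⟩
    apply MvPolynomial.map_injective (algebraMap C L) (algebraMap C L).injective
    rw [map_zero]
    refine MvPolynomial.funext fun t => ?_
    rw [map_zero, MvPolynomial.eval_map, ← MvPolynomial.aeval_def]
    exact Fintype.linearIndependent_iff.1 β.linearIndependent _ (h0 t).2 i
  · rintro ⟨rfl, hP⟩ a ha
    have h1 := hf fun p => β.repr (a p.1) p.2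
    have h2 : (fun x : ℕ × G => ∑ i, (if deg i = x.2 then β.repr (a x) i else 0) • β i) = a := by
      funext x
      conv_rhs => rw [← β.sum_repr (a x)]
      refine sum_congr rfl fun i _ => ?_
      split_ifs with hi
      · rfl
      · rw [hrepr x.2 (a x) (ha x.1 x.2) i hi]
    rw [h2] at h1
    rw [h1]
    simp [hP]

end GenericEvaluation

/-! ### Homogeneous bases. -/

section HomogeneousBasis

theorem IsGrading.exists_homogeneous_basis {C G A : Type*} [Field C] [Group G] [NonUnitalRing A]
    [Module C A] [FiniteDimensional C A] {𝒜 : G → Submodule C A} (h : IsGrading 𝒜) :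
    ∃ (ι : Type) (_ : Fintype ι) (deg : ι → G) (b : Module.Basis ι C A), ∀ i, b i ∈ 𝒜 (deg i) := by
  classical
  have hint : DirectSum.IsInternal 𝒜 := h.bijective_coeLinearMap
  let b := hint.collectedBasis fun g => Module.finBasis C (𝒜 g)
  let e := b.indexEquiv (Module.finBasis C A)
  exact ⟨_, inferInstance, fun i => (e.symm i).1, b.reindex e, fun i => by
    rw [Module.Basis.reindex_apply]
    exact hint.collectedBasis_mem _ _⟩

theorem IsGrading.repr_eq_zero {C G A ι : Type*} [Field C] [Group G] [NonUnitalRing A]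
    [Module C A] [Fintype ι] {𝒜 : G → Submodule C A} (h : IsGrading 𝒜) {deg : ι → G}
    (b : Module.Basis ι C A) (hb : ∀ i, b i ∈ 𝒜 (deg i)) {g : G} {y : A} (hy : y ∈ 𝒜 g) {i : ι}
    (hi : deg i ≠ g) : b.repr y i = 0 := by
  classical
  have h1 := h.proj_of_ne hy hi.symm
  rw [← b.sum_repr y, map_sum] at h1
  simp only [map_smul, h.proj_eq_ite (hb _)] at h1
  have h2 : ∑ j, (if deg j = deg i then b.repr y j else 0) • b j = 0 := by
    rw [← h1]
    refine Finset.sum_congr rfl fun j _ => ?_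
    split_ifs <;> simp
  simpa using Fintype.linearIndependent_iff.1 b.linearIndependent _ h2 i

end HomogeneousBasis
end GradedPI

end

/-! ### The main theorem. -/

open GradedPI
theorem mainTheorem11 {F : Type u} {G : Type w} {A : Type v} [Field F] [Group G] [Finite G]
    [NonUnitalRing A] [Module F A] [IsScalarTower F A A] [SMulCommClass F A A] [Infinite A]
    (𝒜 : G → Submodule F A) (h𝒜 : IsGrading 𝒜) (hsimple : IsGradedSimple 𝒜) (hPI : IsPI F A) :
    ∃ (K : Type v) (_ : Field K) (_ : Algebra F K) (_ : IsAlgClosed K)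
      (H : Subgroup G) (α : TwoCocycle H K) (n : ℕ) (_ : 0 < n) (γ : Fin n → G),
      gradedIdentities F 𝒜 =
        gradedIdentities F
          (fun g => (matrixGrading (twistedGrading α) γ g).restrictScalars F) := by
  obtain ⟨C, _, _, _, _, hC⟩ := hsimple.exists_denseCentroid h𝒜
  have := hC.isScalarTower
  have := hC.smulCommClass
  have := hC.finiteDimensional hsimple hPI
  have hinf : Infinite C := by
    by_contra hfin
    rw [not_infinite_iff_finite] at hfin
    have : Finite A := Module.finite_of_finite C
    exact not_finite A
  let K := AlgebraicClosure C
  have : Infinite K := Infinite.of_injective _ (algebraMap C K).injective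
  have hg := hC.isGrading_baseChange K
  obtain ⟨H, α, n, hn, γ, ψ, hmul, hmem⟩ :=
    (hC.isGradedSimple_baseChange K hsimple).exists_equiv_matrix hg
  refine ⟨K, inferInstance, inferInstance, inferInstance, H, α, n, hn, γ, ?_⟩
  obtain ⟨ι, _, deg, b, hb⟩ := hC.isGrading_component.exists_homogeneous_basis
  let bK := b.baseChange K
  have hbK : ∀ i, bK i ∈ hC.baseChange K (deg i) := fun i => by
    rw [Module.Basis.baseChange_apply]
    exact Submodule.subset_span ⟨b i, hb i, rfl⟩
  -- Transporting the extended basis through `ψ` keeps the structure constants of `b`, now read in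
  -- `K`.
  let β := bK.map ψ.symm
  have hψβ : ∀ i, ψ (β i) = bK i := fun i => by
    rw [Module.Basis.map_apply, LinearEquiv.apply_symm_apply]
  let s : ι → ι → ι → C := fun i j k => b.repr (b i * b j) k
  have hs : ∀ i j, b i * b j = ∑ k, s i j k • b k := fun i j => (b.sum_repr _).symm
  have hsK : ∀ i j, β i * β j = ∑ k, algebraMap C K (s i j k) • β k := by
    intro i j
    apply ψ.injective
    rw [hmul, map_sum]
    simp only [map_smul, hψβ]
    simp only [bK, Module.Basis.baseChange_apply]
    rw [Algebra.TensorProduct.tmul_mul_tmul, one_mul, hs, TensorProduct.tmul_sum]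
    simp
  ext f
  obtain ⟨κ, P, h1, h2⟩ := exists_isGenericValue (L := C) (L' := K) (β := b) (β' := β) deg hs hsK f
  rw [h1.mem_gradedIdentities_iff, h2.mem_gradedIdentities_iff]
  · intro i r
    rw [Submodule.restrictScalars_mem, hmem, map_smul, hψβ]
    exact Submodule.smul_mem _ r (hbK i)
  · intro g y hy i hi
    rw [Submodule.restrictScalars_mem, hmem] at hy
    exact hg.repr_eq_zero bK hbK hy hi
  · intro i r
    exact hC.smul_mem _ r (hb i)
  · intro g y hy i hi
    exact hC.isGrading_component.repr_eq_zero b hb hy hi
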